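/- **Conventions.** A polyhedron is a finite intersection of closed halfspaces, a polyhedral cone is a non-empty polyhedron closed under multiplication by non-negative reals, and a face of $P$ is a set $\{x\in P: a\cdot x=b\}$ where $a\cdot x\le b$ holds on $P$ ($a=0$ allowed). A *complete fan* in $\mathbb{R}^d$ is a finite family $\mathcal N$ of polyhedral cones that contains every non-empty face of each of its cones, in which the intersection of any two cones is a face of both, and whose union is $\mathbb{R}^d$; it is *rational* if each of its cones is generated by rational vectors. Let $\mathcal N^{co1}=\{N\in\mathcal N:\dim N\le d-1\}$. A *rational polytope* is the convex hull of finitely many points with rational coordinates. A *quasipolynomial of degree $d$* is a function $f:\mathbb{Z}\to\mathbb{R}$, $f(t)=\sum_{i=0}^{d}c_i(t)t^i$, with periodic functions $c_i$ (of positive integral period) and $c_d$ not identically zero. For a polytope $Q\subset\mathbb{R}^d$ with interior $Q^\circ$ and an integer $t>0$ let $$\mathrm{In}_{Q^\circ,\mathcal N^{co1}}(t)=\#\Big(\tfrac1t\mathbb{Z}^d\cap\big(Q^\circ\setminus\bigcup\mathcal N^{co1}\big)\Big)$$ be the *inner pruned Ehrhart function*, and let $$\mathrm{Cu}_{Q,\mathcal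 N^{co1}}(t)=\sum_{y\in\frac1t\mathbb{Z}^d}\mathrm{mult}(y)$$ be the *cumulative pruned Ehrhart function*, where $\mathrm{mult}(y)$ is the number of closed full-dimensional cones of $\mathcal N$ containing $y$ if $y\in Q$, and $0$ otherwise. Let $R_1,\dots,R_k$ be the connected components (*regions*) of $Q\setminus\bigcup\mathcal N^{co1}$, and let $$\mathrm{Cu}^{\mathrm{reg}}_{Q,\mathcal N^{co1}}(t)=\sum_{i=1}^k\#\big(\tfrac1t\mathbb{Z}^d\cap\overline{R_i}\big),$$ so that points are counted with the number of closed regions containing them. **Theorem.** Let $Q\subset\mathbb{R}^d$ be a (non-empty) rational polytope of dimension $d$ and $\mathcal N$ a rational complete fan in $\mathbb{R}^d$. Then the functions $\mathrm{In}_{Q^\circ,\mathcal N^{co1}}$, $\mathrm{Cu}_{Q,\mathcal N^{co1}}$ and $\mathrm{Cu}^{\mathrm{reg}}_{Q,\mathcal N^{co1}}$ agree, for all integers $t>0$, with quasipolynomials in $t$ of degree $d$, denoted by the same symbols, and for all $t\in\mathbb{Z}$ $$(-1)^d\,\mathrm{In}_{Q^\circ,\mathcal N^{co1}}(-t)=\mathrm{Cu}^{\mathrm{reg}}_{Q,\mathcal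 N^{co1}}(t).$$ If moreover every full-dimensional cone of $\mathcal N$ that meets $Q$ also meets $Q^\circ$, then for all $t\in\mathbb{Z}$ $$(-1)^d\,\mathrm{In}_{Q^\circ,\mathcal N^{co1}}(-t)=\mathrm{Cu}_{Q,\mathcal N^{co1}}(t).$$ -/

import Mathlib

noncomputable section

namespace PrunedEhrhart

variable {d : ℕ}

/-- The dimension of a (non-empty) subset of `ℝ^d`: the dimension of its affine hull. -/
def dim (A : Set (Fin d → ℝ)) : ℕ :=
  Module.finrank ℝ (affineSpan ℝ A).direction

/-- A vector of `ℝ^d` all of whose coordinates are rational. -/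
def IsRationalVector (v : Fin d → ℝ) : Prop :=
  ∀ i, ∃ q : ℚ, v i = (q : ℝ)

/-- A rational polytope: the convex hull of finitely many points with rational coordinates. -/
def IsRationalPolytope (Q : Set (Fin d → ℝ)) : Prop :=
  ∃ S : Finset (Fin d → ℝ), (∀ v ∈ S, IsRationalVector v) ∧ Q = convexHull ℝ (S : Set (Fin d → ℝ))

/-- A polyhedron: the intersection of finitely many closed halfspaces `a ⬝ x ≤ b`. -/
def IsPolyhedron (P : Set (Fin d → ℝ)) : Prop :=
  ∃ H : Finset ((Fin d → ℝ) × ℝ), P = {x | ∀ h ∈ H, h.1 ⬝ᵥ x ≤ h.2}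

/-- A polyhedral cone: a non-empty polyhedron closed under scaling by non-negative reals. -/
def IsPolyhedralCone (N : Set (Fin d → ℝ)) : Prop :=
  IsPolyhedron N ∧ N.Nonempty ∧ ∀ x ∈ N, ∀ r : ℝ, 0 ≤ r → r • x ∈ N

/-- `F` is a face of `P`: it is cut out of `P` by the equality case of a linear inequality that
is valid on `P`. The zero functional is allowed, so that `P` is a face of itself. -/
def IsFace (F P : Set (Fin d → ℝ)) : Prop :=
  ∃ (a : Fin d → ℝ) (b : ℝ), (∀ x ∈ P, a ⬝ᵥ x ≤ b) ∧ F = {x ∈ P | a ⬝ᵥ x = b}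

/-- A complete fan in `ℝ^d`. -/
structure IsCompleteFan (𝒩 : Set (Set (Fin d → ℝ))) : Prop where
  finite : 𝒩.Finite
  cone : ∀ N ∈ 𝒩, IsPolyhedralCone N
  face_mem : ∀ N ∈ 𝒩, ∀ F, IsFace F N → F.Nonempty → F ∈ 𝒩
  inter_face : ∀ N ∈ 𝒩, ∀ N' ∈ 𝒩, IsFace (N ∩ N') N ∧ IsFace (N ∩ N') N'
  cover : ⋃₀ 𝒩 = Set.univ

/-- A family of cones is rational if each of them is generated, as a cone, by (finitely many)
rational vectors. -/
def IsRationalFan (𝒩 : Set (Set (Fin d → ℝ))) : Prop :=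
  ∀ N ∈ 𝒩, ∃ S : Finset (Fin d → ℝ), (∀ v ∈ S, IsRationalVector v) ∧
    N = (PointedCone.hull ℝ (S : Set (Fin d → ℝ)) : Set (Fin d → ℝ))

/-- The codimension-one fan: all cones that are not full-dimensional. -/
def codimOne (𝒩 : Set (Set (Fin d → ℝ))) : Set (Set (Fin d → ℝ)) :=
  {N ∈ 𝒩 | dim N < d}

/-- The pruned inside-out polytope: the points of `A` off the cones of codimension `≥ 1`. -/
def pruned (A : Set (Fin d → ℝ)) (𝒩 : Set (Set (Fin d → ℝ))) : Set (Fin d → ℝ) :=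
  A \ ⋃₀ codimOne 𝒩

/-- The point `z / t` of the lattice `(1/t) ℤ^d`. -/
def latticePoint (t : ℕ) (z : Fin d → ℤ) : Fin d → ℝ :=
  fun i => (z i : ℝ) / (t : ℝ)

/-- A bounded set contains only finitely many points of `(1/t) ℤ^d`, so the counts and sums below
are over finite sets. -/
theorem finite_latticePoint_mem {A : Set (Fin d → ℝ)} (hA : Bornology.IsBounded A) {t : ℕ}
    (ht : 0 < t) : {z : Fin d → ℤ | latticePoint t z ∈ A}.Finite := by
  obtain ⟨R, hR⟩ := hA.exists_norm_le
  refine Set.Finite.subset (Set.finite_Icc (fun _ => -⌈R * t⌉ : Fin d → ℤ) (fun _ => ⌈R * t⌉)) ?_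
  intro z hz
  have ht' : (0 : ℝ) < t := by exact_mod_cast ht
  have key : ∀ i, |(z i : ℝ)| ≤ R * t := by
    intro i
    have h := (norm_le_pi_norm (latticePoint t z) i).trans (hR _ hz)
    rw [latticePoint, Real.norm_eq_abs, abs_div, abs_of_pos ht', div_le_iff₀ ht'] at h
    exact h
  refine ⟨fun i => ?_, fun i => ?_⟩
  · have h := (abs_le.mp (key i)).1
    have h2 := Int.le_ceil (R * (t : ℝ))
    have h3 : ((-⌈R * (t : ℝ)⌉ : ℤ) : ℝ) ≤ (z i : ℝ) := by push_cast; linarith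
    exact_mod_cast h3
  · have h := (abs_le.mp (key i)).2
    have h3 : (z i : ℝ) ≤ ((⌈R * (t : ℝ)⌉ : ℤ) : ℝ) := h.trans (Int.le_ceil _)
    exact_mod_cast h3

/-- The Ehrhart counting function `#((1/t) ℤ^d ∩ A)`. -/
def ehr (A : Set (Fin d → ℝ)) (t : ℕ) : ℕ :=
  {z : Fin d → ℤ | latticePoint t z ∈ A}.ncard

/-- The inner pruned Ehrhart function of `A` with respect to the fan `𝒩`. -/
def innerEhr (A : Set (Fin d → ℝ)) (𝒩 : Set (Set (Fin d → ℝ))) (t : ℕ) : ℕ :=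
  ehr (pruned A 𝒩) t

open Classical in
/-- The multiplicity of `y`: the number of closed full-dimensional cones of `𝒩` containing `y` if
`y ∈ Q`, and `0` otherwise. -/
def mult (Q : Set (Fin d → ℝ)) (𝒩 : Set (Set (Fin d → ℝ))) (y : Fin d → ℝ) : ℕ :=
  if y ∈ Q then {N ∈ 𝒩 | dim N = d ∧ y ∈ N}.ncard else 0

/-- The cumulative pruned Ehrhart function: the sum of the multiplicities of the points of
`(1/t) ℤ^d`. -/
def cumulativeEhr (Q : Set (Fin d → ℝ)) (𝒩 : Set (Set (Fin d → ℝ))) (t : ℕ) : ℕ :=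
  ∑ᶠ z : Fin d → ℤ, mult Q 𝒩 (latticePoint t z)

/-- The regions: the connected components of the pruned inside-out polytope. -/
def regions (Q : Set (Fin d → ℝ)) (𝒩 : Set (Set (Fin d → ℝ))) : Set (Set (Fin d → ℝ)) :=
  {R | ∃ x ∈ pruned Q 𝒩, R = connectedComponentIn (pruned Q 𝒩) x}

/-- The sum of the Ehrhart functions of the closed regions: points of `(1/t) ℤ^d` are counted with
the number of closed regions containing them. -/
def closedRegionEhr (Q : Set (Fin d → ℝ)) (𝒩 : Set (Set (Fin d → ℝ))) (t : ℕ) : ℕ :=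
  ∑ᶠ R ∈ regions Q 𝒩, ehr (closure R) t

/-- `f` is a quasipolynomial of degree `n`: `f t = c_n(t) t^n + ⋯ + c_1(t) t + c_0(t)` with periodic
coefficient functions `c_i`, where `c_n` is not the zero function. -/
def IsQuasipolynomial (f : ℤ → ℝ) (n : ℕ) : Prop :=
  ∃ c : ℕ → ℤ → ℝ, (∀ i, ∃ k : ℕ, 0 < k ∧ Function.Periodic (c i) (k : ℤ)) ∧ c n ≠ 0 ∧
    ∀ t : ℤ, f t = ∑ i ∈ Finset.range (n + 1), c i t * (t : ℝ) ^ i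

end PrunedEhrhart

end

noncomputable section

namespace PrunedEhrhart

/-! A full-dimensional cone `N` contributes the lattice points of the polytope `N ∩ Q` to the
cumulative count. If its interior meets that of `Q`, it contributes those of `interior (N ∩ Q)` to
the inner count, and `N ∩ Q` is the closure of exactly one region. All three functions are therefore
finite sums of Ehrhart functions over full-dimensional cones, and the theorem follows from Ehrhart's
theorem and Ehrhart-Macdonald reciprocity (`exists_ehrhart`), applied cone by cone. The cumulative
and the regional sum differ only by cones meeting `Q` but not its interior, which the extra
hypothesis excludes.

Reciprocity is proved by summing out one variable at a time, with a sign `σ = ±1` carried along.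
Consider weights built from indicators of half-spaces at `y + σ v` and quasipolynomials evaluated at
`σ y`. Summing over a variable bounded on both sides gives `σ` times a weight of the same kind in
the other variables (`exists_hasSum_boundedGens`): telescoping yields `W(⌊B⌋) - W(⌈A⌉ - 1)`, and
reflection exchanges the endpoints up to a rounding error that vanishes when `v` is generic. After
`d` summations one quasipolynomial `q` describes both signs, through `σ ^ d * q (σ t)`. A small
generic `v` pointing into the cone over the polytope keeps every facet inequality weak for `σ = 1`
and makes it strict for `σ = -1`, so the two cases count the closed polytope and its interior.

Integral inequalities for rational cones come from Fourier-Motzkin elimination, those for polytopes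
by homogenization. The degree `d` is read off from upper and lower growth bounds of order `t ^ d`.
-/

/-! ### Multivariate quasipolynomial functions -/

/-- Functions on `ℤ^n` given by a polynomial. -/
def IsPolyFun {n : ℕ} (f : (Fin n → ℤ) → ℝ) : Prop :=
  ∃ p : MvPolynomial (Fin n) ℝ, ∀ y, f y = MvPolynomial.eval (fun i => (y i : ℝ)) p

namespace IsPolyFun

variable {n m : ℕ} {f g : (Fin n → ℤ) → ℝ}

theorem const (c : ℝ) : IsPolyFun (fun _ : Fin n → ℤ => c) :=
  ⟨MvPolynomial.C c, fun _ => by simp⟩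

theorem coord (i : Fin n) : IsPolyFun (fun y : Fin n → ℤ => (y i : ℝ)) :=
  ⟨MvPolynomial.X i, fun _ => by simp⟩

theorem add (hf : IsPolyFun f) (hg : IsPolyFun g) : IsPolyFun (fun y => f y + g y) := by
  obtain ⟨p, hp⟩ := hf
  obtain ⟨q, hq⟩ := hg
  exact ⟨p + q, fun y => by simp [hp, hq]⟩

theorem mul (hf : IsPolyFun f) (hg : IsPolyFun g) : IsPolyFun (fun y => f y * g y) := by
  obtain ⟨p, hp⟩ := hf
  obtain ⟨q, hq⟩ := hg
  exact ⟨p * q, fun y => by simp [hp, hq]⟩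

theorem sub (hf : IsPolyFun f) (hg : IsPolyFun g) : IsPolyFun (fun y => f y - g y) := by
  obtain ⟨p, hp⟩ := hf
  obtain ⟨q, hq⟩ := hg
  exact ⟨p - q, fun y => by simp [hp, hq]⟩

theorem sum {ι : Type*} (s : Finset ι) {F : ι → (Fin n → ℤ) → ℝ} (h : ∀ i ∈ s, IsPolyFun (F i)) :
    IsPolyFun (fun y => ∑ i ∈ s, F i y) := by
  classical
  induction s using Finset.induction_on with
  | empty => simpa using const 0
  | insert a s ha ih =>
    simp only [Finset.sum_insert ha]
    exact (h a (by simp)).add (ih fun i hi => h i (by simp [hi]))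

theorem linear (a : Fin n → ℤ) : IsPolyFun (fun y : Fin n → ℤ => ((a ⬝ᵥ y : ℤ) : ℝ)) := by
  have : (fun y : Fin n → ℤ => ((a ⬝ᵥ y : ℤ) : ℝ)) = fun y => ∑ i, (a i : ℝ) * (y i : ℝ) := by
    ext y; simp [dotProduct]
  rw [this]
  exact sum _ fun i _ => (const _).mul (coord i)

theorem comp (hf : IsPolyFun f) {g : (Fin m → ℤ) → (Fin n → ℤ)}
    (hg : ∀ i, IsPolyFun (fun y => (g y i : ℝ))) : IsPolyFun (fun y => f (g y)) := by
  obtain ⟨p, hp⟩ := hf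
  choose q hq using hg
  refine ⟨MvPolynomial.bind₁ q p, fun y => ?_⟩
  have h : (fun i => (g y i : ℝ)) = fun i => MvPolynomial.eval (fun i => (y i : ℝ)) (q i) :=
    funext fun i => hq i y
  change f (g y) = _
  rw [hp, h]
  simp only [← MvPolynomial.coe_aeval_eq_eval, RingHom.coe_coe, MvPolynomial.aeval_bind₁]

theorem cons {a : (Fin m → ℤ) → ℤ} {g : (Fin m → ℤ) → (Fin n → ℤ)}
    (ha : IsPolyFun (fun y => (a y : ℝ))) (hg : ∀ i, IsPolyFun (fun y => (g y i : ℝ)))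
    (i : Fin (n + 1)) :
    IsPolyFun (fun y => ((Fin.cons (a y) (g y) : Fin (n + 1) → ℤ) i : ℝ)) := by
  refine Fin.cases ?_ (fun j => ?_) i
  · simpa using ha
  · simpa using hg j

end IsPolyFun

/-- Bernoulli polynomials satisfy `B_{k+1}(1 + x) - B_{k+1}(x) = (k + 1) x^k`, so `P(x) = B_{k+1}(1
+ x) / (k + 1)` works. -/
theorem exists_polynomial_sub_eq_pow (k : ℕ) :
    ∃ P : Polynomial ℝ, ∀ x : ℤ, P.eval (x : ℝ) - P.eval ((x : ℝ) - 1) = (x : ℝ) ^ k := by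
  refine ⟨((Polynomial.bernoulli (k + 1)).comp (1 + Polynomial.X)).map (algebraMap ℚ ℝ) *
    Polynomial.C ((k + 1 : ℝ)⁻¹), fun x => ?_⟩
  have key : ∀ z : ℤ, (((Polynomial.bernoulli (k + 1)).comp (1 + Polynomial.X)).map
      (algebraMap ℚ ℝ)).eval (z : ℝ) = (((Polynomial.bernoulli (k + 1)).eval (1 + (z : ℚ)) : ℚ) : ℝ) := by
    intro z
    have h := Polynomial.eval_map_apply (p := (Polynomial.bernoulli (k + 1)).comp (1 + Polynomial.X))
      (algebraMap ℚ ℝ) (z : ℚ)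
    simpa [Polynomial.eval_comp] using h
  have h1 : ((x : ℝ) - 1) = ((x - 1 : ℤ) : ℝ) := by push_cast; ring
  rw [Polynomial.eval_mul, Polynomial.eval_mul, h1, key, key, Polynomial.bernoulli_eval_one_add]
  have h2 : (1 + ((x - 1 : ℤ) : ℚ)) = x := by push_cast; ring
  rw [h2]
  have : (k + 1 : ℝ) ≠ 0 := by positivity
  push_cast
  simp only [Polynomial.eval_C]
  field_simp
  simp

theorem IsPolyFun.exists_antidifference {n : ℕ} {f : (Fin (n + 1) → ℤ) → ℝ} (hf : IsPolyFun f) :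
    ∃ F : (Fin (n + 1) → ℤ) → ℝ, IsPolyFun F ∧
      ∀ (x : ℤ) (y : Fin n → ℤ), F (Fin.cons x y) - F (Fin.cons (x - 1) y) = f (Fin.cons x y) := by
  obtain ⟨p, hp⟩ := hf
  obtain rfl : f = fun y => MvPolynomial.eval (fun i => (y i : ℝ)) p := funext hp
  clear hp
  induction p using MvPolynomial.induction_on' with
  | add p q hp hq =>
    obtain ⟨P, hP, hP'⟩ := hp
    obtain ⟨R, hR, hR'⟩ := hq
    refine ⟨_, hP.add hR, fun x y => ?_⟩
    simp only [map_add, ← hP', ← hR']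
    ring
  | monomial u a =>
    obtain ⟨S, hS⟩ := exists_polynomial_sub_eq_pow (u 0)
    refine ⟨fun y => S.eval (y 0 : ℝ) * (a * ∏ i : Fin n, (y i.succ : ℝ) ^ u i.succ),
      ⟨Polynomial.aeval (MvPolynomial.X 0) S *
        (MvPolynomial.C a * ∏ i : Fin n, MvPolynomial.X i.succ ^ u i.succ), fun y => ?_⟩,
      fun x y => ?_⟩
    · have : MvPolynomial.eval (fun i => (y i : ℝ))
          (Polynomial.aeval (MvPolynomial.X (0 : Fin (n + 1))) S) = S.eval (y 0 : ℝ) := by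
        rw [← MvPolynomial.coe_aeval_eq_eval, RingHom.coe_coe, ← Polynomial.aeval_algHom_apply]
        simp [Polynomial.aeval_def, Polynomial.eval₂_eq_eval_map]
      simp [this, map_prod]
    · simp only [Fin.cons_zero, Fin.cons_succ]
      rw [← sub_mul]
      push_cast
      rw [hS, MvPolynomial.eval_monomial, Finsupp.prod_fintype _ _ (by simp), Fin.prod_univ_succ]
      simp
      ring

/-- Functions on `ℤ^n` that are polynomial on each residue class modulo some `M > 0`. -/
def IsQuasiPolyFun {n : ℕ} (f : (Fin n → ℤ) → ℝ) : Prop :=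
  ∃ M : ℕ, 0 < M ∧ ∀ r : Fin n → ℤ, IsPolyFun (fun y => f ((M : ℤ) • y + r))

namespace IsQuasiPolyFun

variable {n : ℕ} {f g : (Fin n → ℤ) → ℝ}

theorem of_mul {M k : ℕ} (h : ∀ r : Fin n → ℤ, IsPolyFun (fun y => f ((M : ℤ) • y + r)))
    (r : Fin n → ℤ) : IsPolyFun (fun y => f (((M * k : ℕ) : ℤ) • y + r)) := by
  have h2 := (h r).comp (g := fun y : Fin n → ℤ => (k : ℤ) • y)
    (fun i => by simpa using (IsPolyFun.const (k : ℝ)).mul (IsPolyFun.coord i))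
  simpa [mul_assoc] using h2

theorem of_isPolyFun (hf : IsPolyFun f) : IsQuasiPolyFun f :=
  ⟨1, one_pos, fun r => hf.comp fun i => by
    simpa using (IsPolyFun.coord i).add (IsPolyFun.const (r i : ℝ))⟩

theorem const (c : ℝ) : IsQuasiPolyFun (fun _ : Fin n → ℤ => c) := of_isPolyFun (.const c)

theorem exists_common (hf : IsQuasiPolyFun f) (hg : IsQuasiPolyFun g) :
    ∃ M : ℕ, 0 < M ∧ ∀ r : Fin n → ℤ, IsPolyFun (fun y => f ((M : ℤ) • y + r)) ∧
      IsPolyFun (fun y => g ((M : ℤ) • y + r)) := by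
  obtain ⟨M, hM, h⟩ := hf
  obtain ⟨K, hK, k⟩ := hg
  refine ⟨M * K, by positivity, fun r => ⟨of_mul h r, ?_⟩⟩
  rw [mul_comm]
  exact of_mul k r

theorem add (hf : IsQuasiPolyFun f) (hg : IsQuasiPolyFun g) :
    IsQuasiPolyFun (fun y => f y + g y) := by
  obtain ⟨M, hM, h⟩ := hf.exists_common hg
  exact ⟨M, hM, fun r => (h r).1.add (h r).2⟩

theorem sub (hf : IsQuasiPolyFun f) (hg : IsQuasiPolyFun g) :
    IsQuasiPolyFun (fun y => f y - g y) := by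
  obtain ⟨M, hM, h⟩ := hf.exists_common hg
  exact ⟨M, hM, fun r => (h r).1.sub (h r).2⟩

theorem mul (hf : IsQuasiPolyFun f) (hg : IsQuasiPolyFun g) :
    IsQuasiPolyFun (fun y => f y * g y) := by
  obtain ⟨M, hM, h⟩ := hf.exists_common hg
  exact ⟨M, hM, fun r => (h r).1.mul (h r).2⟩

/-- Substitution of an integer valued function that is linear along a sublattice. -/
theorem comp_cons {f : (Fin (n + 1) → ℤ) → ℝ} (hf : IsQuasiPolyFun f) {m : (Fin n → ℤ) → ℤ}
    {c : ℕ} (hc : 0 < c) {a : Fin n → ℤ}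
    (hm : ∀ y r : Fin n → ℤ, m ((c : ℤ) • y + r) = a ⬝ᵥ y + m r) :
    IsQuasiPolyFun (fun y => f (Fin.cons (m y) y)) := by
  obtain ⟨M, hM, h⟩ := hf
  refine ⟨M * c, by positivity, fun r => ?_⟩
  have h2 := (h (Fin.cons (m r) r)).comp
    (g := fun y : Fin n → ℤ => (Fin.cons (a ⬝ᵥ y) ((c : ℤ) • y) : Fin (n + 1) → ℤ))
    (IsPolyFun.cons (.linear a)
      (fun i => by simpa using (IsPolyFun.const (c : ℝ)).mul (IsPolyFun.coord i)))
  convert h2 using 3 with y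
  have h3 : ((M * c : ℕ) : ℤ) • y + r = (c : ℤ) • ((M : ℤ) • y) + r := by
    rw [smul_smul]; push_cast; rw [mul_comm]
  refine funext fun i => Fin.cases ?_ (fun j => ?_) i
  · simp only [Fin.cons_zero, Pi.add_apply, Pi.smul_apply, smul_eq_mul]
    rw [h3, hm, dotProduct_smul]
    simp
  · simp [mul_assoc]

/-- Any antidifference is determined up to a function of the remaining variables, so the signed
partial sums serve; the point is that they are again polynomial on residue classes. -/
theorem exists_antidifference {f : (Fin (n + 1) → ℤ) → ℝ} (hf : IsQuasiPolyFun f) :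
    ∃ F : (Fin (n + 1) → ℤ) → ℝ, IsQuasiPolyFun F ∧
      ∀ (x : ℤ) (y : Fin n → ℤ), F (Fin.cons x y) - F (Fin.cons (x - 1) y) = f (Fin.cons x y) := by
  obtain ⟨M, hM, h⟩ := hf
  -- Signed sum from `0` to `X`, so that the difference equation holds for negative `X` as well.
  let S : ℤ → (Fin n → ℤ) → ℝ := fun X Y =>
    ∑ i ∈ Finset.Ioc 0 X, f (Fin.cons i Y) - ∑ i ∈ Finset.Ioc X 0, f (Fin.cons i Y)
  have hS : ∀ X Y, S X Y - S (X - 1) Y = f (Fin.cons X Y) := by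
    intro X Y
    rcases le_or_gt X 0 with hX | hX
    · have h1 : Finset.Ioc 0 X = ∅ := Finset.Ioc_eq_empty (by omega)
      have h2 : Finset.Ioc 0 (X - 1) = ∅ := Finset.Ioc_eq_empty (by omega)
      have h3 : Finset.Ioc (X - 1) 0 = insert X (Finset.Ioc X 0) := by ext z; simp; omega
      simp only [S, h1, h2, h3]
      rw [Finset.sum_insert (by simp)]
      simp
    · have h1 : Finset.Ioc X 0 = ∅ := Finset.Ioc_eq_empty (by omega)
      have h2 : Finset.Ioc (X - 1) 0 = ∅ := Finset.Ioc_eq_empty (by omega)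
      have h3 : Finset.Ioc 0 X = insert X (Finset.Ioc 0 (X - 1)) := by ext z; simp; omega
      simp only [S, h1, h2, h3]
      rw [Finset.sum_insert (by simp)]
      simp
  have hS' : ∀ (k : ℕ) X Y, S X Y - S (X - k) Y =
      ∑ j ∈ Finset.range k, f (Fin.cons (X - j) Y) := by
    intro k X Y
    induction k with
    | zero => simp
    | succ k ih =>
      rw [Finset.sum_range_succ, ← ih, ← hS (X - k) Y]
      have : X - ((k + 1 : ℕ) : ℤ) = X - k - 1 := by push_cast; ring
      rw [this]
      ring
  refine ⟨fun y => S (y 0) (Fin.tail y), ⟨M, hM, fun r => ?_⟩, fun x y => by simpa using hS x y⟩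
  -- Raising the quotient variable by one moves the argument by `M`, so the increment of `S` sums
  -- `f` over `M` consecutive values, each in a fixed residue class, and is polynomial. An
  -- antidifference `Q` of this increment differs from `S` on the class only by a function of the
  -- other variables, found by setting the quotient variable to `0`.
  have hq : IsPolyFun (fun y : Fin (n + 1) → ℤ => ∑ j ∈ Finset.range M,
      f ((M : ℤ) • y + Fin.cons (r 0 - j) (Fin.tail r))) := IsPolyFun.sum _ fun j _ => h _
  obtain ⟨Q, hQ, hQ'⟩ := hq.exists_antidifference
  have hcons : ∀ (x i : ℤ) (y : Fin n → ℤ), (M : ℤ) • (Fin.cons x y : Fin (n + 1) → ℤ) +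
      Fin.cons i (Fin.tail r) = Fin.cons (M * x + i) ((M : ℤ) • y + Fin.tail r) := by
    intro x i y
    refine funext fun i => Fin.cases ?_ (fun j => ?_) i <;> simp
  let D : ℤ → (Fin n → ℤ) → ℝ := fun x y => S (M * x + r 0) ((M : ℤ) • y + Fin.tail r)
  have hD : ∀ x y, D x y - D (x - 1) y = Q (Fin.cons x y) - Q (Fin.cons (x - 1) y) := by
    intro x y
    rw [hQ']
    have h1 : (M : ℤ) * (x - 1) + r 0 = M * x + r 0 - M := by ring
    simp only [D, h1, hcons]
    rw [hS']
    refine Finset.sum_congr rfl fun j _ => ?_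
    rw [add_sub_assoc]
  have hD0 : ∀ x y, D x y - Q (Fin.cons x y) = D 0 y - Q (Fin.cons 0 y) := by
    intro x y
    induction x using Int.induction_on with
    | zero => rfl
    | succ k ih =>
      have := hD (k + 1) y
      rw [add_sub_cancel_right] at this
      linarith
    | pred k ih =>
      have := hD (-k) y
      linarith
  have hpoly0 : IsPolyFun (fun y : Fin n → ℤ => D 0 y) := by
    have h0 : ∀ i : ℤ, IsPolyFun (fun y : Fin n → ℤ => f (Fin.cons i ((M : ℤ) • y + Fin.tail r))) := by
      intro i
      have := (h (Fin.cons i (Fin.tail r))).comp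
        (g := fun y : Fin n → ℤ => (Fin.cons 0 y : Fin (n + 1) → ℤ))
        (IsPolyFun.cons (a := fun _ => 0) (by simpa using IsPolyFun.const 0) IsPolyFun.coord)
      simpa only [hcons, mul_zero, zero_add] using this
    simpa [D, S] using (IsPolyFun.sum _ fun i _ => h0 i).sub (IsPolyFun.sum _ fun i _ => h0 i)
  have hfin : IsPolyFun (fun y : Fin (n + 1) → ℤ => Q y + (D 0 (Fin.tail y) -
      Q (Fin.cons 0 (Fin.tail y)))) := by
    have ht : ∀ i, IsPolyFun (fun y : Fin (n + 1) → ℤ => ((Fin.tail y : Fin n → ℤ) i : ℝ)) :=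
      fun i => IsPolyFun.coord i.succ
    refine hQ.add ((hpoly0.comp ht).sub (hQ.comp ?_))
    exact IsPolyFun.cons (a := fun _ => 0) (by simpa using IsPolyFun.const 0) ht
  convert hfin using 2 with y
  rw [← hD0 (y 0), Fin.cons_self_tail]
  simp only [D, Pi.add_apply, Pi.smul_apply, smul_eq_mul, add_sub_cancel]
  congr 1

end IsQuasiPolyFun

/-- Telescoping. The case `b = a - 1` of an empty interval is included: real bounds `A ≤ B` may have
no integer between them. -/
theorem sum_Icc_eq_sub {F f : ℤ → ℝ} (h : ∀ x, F x - F (x - 1) = f x) {a b : ℤ}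
    (hab : a - 1 ≤ b) : ∑ x ∈ Finset.Icc a b, f x = F b - F (a - 1) := by
  obtain ⟨k, rfl⟩ : ∃ k : ℕ, b = a - 1 + k := ⟨(b - (a - 1)).toNat, by omega⟩
  clear hab
  induction k with
  | zero => simp
  | succ k ih =>
    have : Finset.Icc a (a - 1 + (k + 1 : ℕ)) =
        insert (a - 1 + (k + 1 : ℕ)) (Finset.Icc a (a - 1 + k)) := by
      ext z; simp; omega
    rw [this, Finset.sum_insert (by simp), ih, ← h]
    have : a - 1 + ((k + 1 : ℕ) : ℤ) - 1 = a - 1 + k := by push_cast; ring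
    rw [this]
    ring

/-! ### The algebra of weighted half-space indicators -/

/-- The linear form `a` at the point `y + σ v`. -/
def shiftedForm {n : ℕ} (a : Fin n → ℤ) (v : Fin n → ℝ) (σ : ℤ) (y : Fin n → ℤ) : ℝ :=
  ∑ i, (a i : ℝ) * (y i + σ * v i)

open Classical in
/-- The indicator function of the half-space `a ≥ 0`, at the point `y + σ v`. -/
def halfInd {n : ℕ} (a : Fin n → ℤ) (v : Fin n → ℝ) (σ : ℤ) (y : Fin n → ℤ) : ℝ :=
  if 0 ≤ shiftedForm a v σ y then 1 else 0

/-- The algebra generated by half-space indicators at `y + σ v` and quasipolynomials in `σ y`. -/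
def weightAlg {n : ℕ} (v : Fin n → ℝ) : Subalgebra ℝ (ℤ → (Fin n → ℤ) → ℝ) :=
  Algebra.adjoin ℝ (Set.range (fun a => halfInd a v) ∪
    {F | ∃ w : (Fin n → ℤ) → ℝ, IsQuasiPolyFun w ∧ F = fun σ y => w (σ • y)})

theorem halfInd_mem {n : ℕ} (a : Fin n → ℤ) (v : Fin n → ℝ) : halfInd a v ∈ weightAlg v :=
  Algebra.subset_adjoin (Or.inl ⟨a, rfl⟩)

theorem quasiPoly_mem {n : ℕ} {v : Fin n → ℝ} {w : (Fin n → ℤ) → ℝ} (hw : IsQuasiPolyFun w) :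
    (fun σ y => w (σ • y)) ∈ weightAlg v :=
  Algebra.subset_adjoin (Or.inr ⟨w, hw, rfl⟩)

theorem shiftedForm_cons {n : ℕ} (a : Fin (n + 1) → ℤ) (v : Fin (n + 1) → ℝ) (σ x : ℤ)
    (y : Fin n → ℤ) : shiftedForm a v σ (Fin.cons x y) =
      a 0 * (x + σ * v 0) + shiftedForm (Fin.tail a) (Fin.tail v) σ y := by
  simp [shiftedForm, Fin.sum_univ_succ, Fin.tail]

theorem shiftedForm_succ {n : ℕ} (a : Fin (n + 1) → ℤ) (v : Fin (n + 1) → ℝ) (σ : ℤ)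
    (y : Fin (n + 1) → ℤ) : shiftedForm a v σ y =
      a 0 * (y 0 + σ * v 0) + shiftedForm (Fin.tail a) (Fin.tail v) σ (Fin.tail y) := by
  rw [← shiftedForm_cons, Fin.cons_self_tail]

theorem shiftedForm_comb {n : ℕ} (a b : Fin n → ℤ) (c k : ℤ) (v : Fin n → ℝ) (σ : ℤ)
    (y : Fin n → ℤ) : shiftedForm (c • a + k • b) v σ y =
      c * shiftedForm a v σ y + k * shiftedForm b v σ y := by
  simp only [shiftedForm, Finset.mul_sum, ← Finset.sum_add_distrib]
  refine Finset.sum_congr rfl fun i _ => ?_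
  simp
  ring

theorem shiftedForm_neg {n : ℕ} (a : Fin n → ℤ) (v : Fin n → ℝ) (y : Fin n → ℤ) :
    shiftedForm a v (-1) y = -shiftedForm a v 1 (-y) := by
  simp only [shiftedForm, ← Finset.sum_neg_distrib]
  refine Finset.sum_congr rfl fun i _ => ?_
  simp
  ring

/-- Half-space indicators do not depend on a variable of coefficient zero. -/
theorem halfInd_of_zero {n : ℕ} {a : Fin (n + 1) → ℤ} (ha : a 0 = 0) (v : Fin (n + 1) → ℝ) (σ : ℤ)
    (y : Fin (n + 1) → ℤ) :
    halfInd a v σ y = halfInd (Fin.tail a) (Fin.tail v) σ (Fin.tail y) := by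
  simp [halfInd, shiftedForm_succ a v, ha]

/-- Of two bounds on the same side for a variable, the stronger one is decided by a linear form in
the other variables. -/
theorem halfInd_mul_halfInd {n : ℕ} {a b : Fin (n + 1) → ℤ} {c k : ℤ} (hc : 0 < c) (hk : 0 < k)
    (h : c * a 0 = k * b 0) (v : Fin (n + 1) → ℝ) (σ : ℤ) (y : Fin (n + 1) → ℤ) :
    halfInd a v σ y * halfInd b v σ y =
      halfInd (Fin.tail (c • a + (-k) • b)) (Fin.tail v) σ (Fin.tail y) * halfInd b v σ y +
      (1 - halfInd (Fin.tail (c • a + (-k) • b)) (Fin.tail v) σ (Fin.tail y)) *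
        halfInd a v σ y := by
  have h0 : (c • a + (-k) • b) 0 = 0 := by simp [h]
  rw [← halfInd_of_zero h0]
  simp only [halfInd, shiftedForm_comb]
  have hc' : (0 : ℝ) < c := by exact_mod_cast hc
  have hk' : (0 : ℝ) < k := by exact_mod_cast hk
  push_cast
  generalize shiftedForm a v σ y = A
  generalize shiftedForm b v σ y = B
  by_cases hA : 0 ≤ A <;> by_cases hB : 0 ≤ B <;> by_cases hAB : 0 ≤ (c : ℝ) * A + -(k : ℝ) * B <;>
    simp only [hA, hB, hAB, if_true, if_false] <;> first | (norm_num; done) | (exfalso; nlinarith)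

/-- Generators of the space of functions with one lower and one upper bound for variable `0`. -/
def boundedGens {n : ℕ} (v : Fin (n + 1) → ℝ) : Set (ℤ → (Fin (n + 1) → ℤ) → ℝ) :=
  {F | ∃ e ∈ weightAlg (Fin.tail v), ∃ w : (Fin (n + 1) → ℤ) → ℝ, IsQuasiPolyFun w ∧
    ∃ a b : Fin (n + 1) → ℤ, 0 < a 0 ∧ b 0 < 0 ∧
      F = fun σ y => e σ (Fin.tail y) * w (σ • y) * halfInd a v σ y * halfInd b v σ y}

/-- It suffices to multiply a generator by a generator of the algebra. A new half-space is a second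
lower bound, a second upper bound, or free of variable `0`, according to the sign of its leading
coefficient. In the first two cases a form `q` in the other variables decides which bound is
stronger and splits the product into two generators. -/
theorem mul_mem_span_boundedGens {n : ℕ} {v : Fin (n + 1) → ℝ}
    {f : ℤ → (Fin (n + 1) → ℤ) → ℝ} (hf : f ∈ weightAlg v) :
    ∀ F ∈ Submodule.span ℝ (boundedGens v), f * F ∈ Submodule.span ℝ (boundedGens v) := by
  refine Algebra.adjoin_induction ?_ ?_ ?_ ?_ hf
  · intro g hg F hF
    induction hF using Submodule.span_induction with
    | zero => simp
    | add F G _ _ hF hG => rw [mul_add]; exact add_mem hF hG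
    | smul r F _ hF => rw [mul_smul_comm]; exact Submodule.smul_mem _ _ hF
    | mem F hF =>
      obtain ⟨e, he, w, hw, a, b, ha, hb, rfl⟩ := hF
      rcases hg with ⟨z, rfl⟩ | ⟨u, hu, rfl⟩
      · rcases lt_trichotomy (z 0) 0 with hz | hz | hz
        · set q := halfInd (Fin.tail ((-z 0) • b + (-(-b 0)) • z)) (Fin.tail v) with hq
          have hqm : q ∈ weightAlg (Fin.tail v) := halfInd_mem _ _
          have key := halfInd_mul_halfInd (a := b) (b := z) (c := -z 0) (k := -b 0)
            (by omega) (by omega) (by ring) v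
          have : (halfInd z v * fun σ y => e σ (Fin.tail y) * w (σ • y) * halfInd a v σ y *
              halfInd b v σ y) =
              (fun σ y => (e * q) σ (Fin.tail y) * w (σ • y) * halfInd a v σ y * halfInd z v σ y) +
              (fun σ y => (e * (1 - q)) σ (Fin.tail y) * w (σ • y) * halfInd a v σ y *
                halfInd b v σ y) := by
            ext σ y
            have := key σ y
            rw [← hq] at this
            simp only [Pi.mul_apply, Pi.add_apply, Pi.sub_apply, Pi.one_apply]
            linear_combination e σ (Fin.tail y) * w (σ • y) * halfInd a v σ y * this
          rw [this]
          exact add_mem (Submodule.subset_span ⟨_, mul_mem he hqm, w, hw, a, z, ha, hz, rfl⟩)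
            (Submodule.subset_span ⟨_, mul_mem he (sub_mem (one_mem _) hqm), w, hw, a, b, ha, hb, rfl⟩)
        · refine Submodule.subset_span ⟨e * halfInd (Fin.tail z) (Fin.tail v),
            mul_mem he (halfInd_mem _ _), w, hw, a, b, ha, hb, ?_⟩
          ext σ y
          simp only [Pi.mul_apply, halfInd_of_zero hz]
          ring
        · set q := halfInd (Fin.tail (z 0 • a + (-a 0) • z)) (Fin.tail v) with hq
          have hqm : q ∈ weightAlg (Fin.tail v) := halfInd_mem _ _
          have key := halfInd_mul_halfInd (a := a) (b := z) (c := z 0) (k := a 0)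
            (by omega) (by omega) (by ring) v
          have : (halfInd z v * fun σ y => e σ (Fin.tail y) * w (σ • y) * halfInd a v σ y *
              halfInd b v σ y) =
              (fun σ y => (e * q) σ (Fin.tail y) * w (σ • y) * halfInd z v σ y * halfInd b v σ y) +
              (fun σ y => (e * (1 - q)) σ (Fin.tail y) * w (σ • y) * halfInd a v σ y *
                halfInd b v σ y) := by
            ext σ y
            have := key σ y
            rw [← hq] at this
            simp only [Pi.mul_apply, Pi.add_apply, Pi.sub_apply, Pi.one_apply]
            linear_combination e σ (Fin.tail y) * w (σ • y) * halfInd b v σ y * this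
          rw [this]
          exact add_mem (Submodule.subset_span ⟨_, mul_mem he hqm, w, hw, z, b, hz, hb, rfl⟩)
            (Submodule.subset_span ⟨_, mul_mem he (sub_mem (one_mem _) hqm), w, hw, a, b, ha, hb, rfl⟩)
      · refine Submodule.subset_span ⟨e, he, _, hw.mul hu, a, b, ha, hb, ?_⟩
        ext σ y
        simp only [Pi.mul_apply]
        ring
  · intro r F hF
    rw [← Algebra.smul_def]
    exact Submodule.smul_mem _ _ hF
  · intro f g _ _ hf hg F hF
    rw [add_mul]
    exact add_mem (hf F hF) (hg F hF)
  · intro f g _ _ hf hg F hF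
    rw [mul_assoc]
    exact hf _ (hg F hF)

/-- The signs `σ` for which summation is compatible with the substitution `y ↦ σ y`: always `1`, and
also `-1` if no integral linear form takes an integral value at `v`. -/
def IsGoodSign {n : ℕ} (v : Fin n → ℝ) (σ : ℤ) : Prop :=
  σ = 1 ∨ (σ = -1 ∧ ∀ a : Fin n → ℤ, a ≠ 0 → ∀ m : ℤ, ∑ i, (a i : ℝ) * v i ≠ m)

theorem IsGoodSign.tail {n : ℕ} {v : Fin (n + 1) → ℝ} {σ : ℤ} (h : IsGoodSign v σ) :
    IsGoodSign (Fin.tail v) σ := by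
  rcases h with h | ⟨h, h'⟩
  · exact Or.inl h
  · refine Or.inr ⟨h, fun a ha m => ?_⟩
    have := h' (Fin.cons 0 a) (fun h0 => ha (by
      ext i; simpa using congrFun h0 i.succ)) m
    simpa [Fin.sum_univ_succ, Fin.tail] using this

theorem hasSum_Icc_of_eq_zero {f : ℤ → ℝ} {a b : ℤ} (h : ∀ x, (x < a ∨ b < x) → f x = 0) :
    HasSum f (∑ x ∈ Finset.Icc a b, f x) :=
  hasSum_sum_of_ne_finset_zero fun x hx => h x (by
    rw [Finset.mem_Icc] at hx; omega)

theorem sum_Icc_neg (f : ℤ → ℝ) (a b : ℤ) :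
    ∑ x ∈ Finset.Icc a b, f (-x) = ∑ x ∈ Finset.Icc (-b) (-a), f x := by
  refine Finset.sum_nbij' (fun x => -x) (fun x => -x) ?_ ?_ ?_ ?_ ?_ <;> simp <;> omega

/-- A step in `c ℤ^n` changes the quotient by an integer, which passes through the floor. This is
the linearity along a sublattice that `comp_cons` needs for summation endpoints. -/
theorem floor_quasilinear {n : ℕ} (s : Fin n → ℤ) (v : Fin n → ℝ) {c : ℕ} (hc : 0 < c) (ρ : ℝ)
    (y r : Fin n → ℤ) : ⌊shiftedForm s v 1 ((c : ℤ) • y + r) / c - ρ⌋ =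
      s ⬝ᵥ y + ⌊shiftedForm s v 1 r / c - ρ⌋ := by
  have hc' : (c : ℝ) ≠ 0 := by positivity
  have : shiftedForm s v 1 ((c : ℤ) • y + r) = c * ((s ⬝ᵥ y : ℤ) : ℝ) + shiftedForm s v 1 r := by
    simp only [shiftedForm, dotProduct, Int.cast_sum, Finset.mul_sum, ← Finset.sum_add_distrib]
    refine Finset.sum_congr rfl fun i _ => ?_
    simp
    ring
  rw [this, add_div, mul_div_cancel_left₀ _ hc', add_sub_assoc, Int.floor_intCast_add]

/-- An integral endpoint would, after clearing the denominator `c`, give the form `a` an integral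
value at `v`. -/
theorem shiftedForm_tail_div_not_int {n : ℕ} {v : Fin (n + 1) → ℝ}
    (h : ∀ a : Fin (n + 1) → ℤ, a ≠ 0 → ∀ m : ℤ, ∑ i, (a i : ℝ) * v i ≠ m)
    {a : Fin (n + 1) → ℤ} {c : ℤ} (hc : c ≠ 0) (hca : a 0 = c) (y : Fin n → ℤ) (m : ℤ) :
    -(shiftedForm (Fin.tail a) (Fin.tail v) 1 y) / c - v 0 ≠ m := by
  intro h0
  have hc' : (c : ℝ) ≠ 0 := by exact_mod_cast hc
  refine h a (fun h1 => hc (by rw [← hca, h1]; rfl)) (-(c * m) - Fin.tail a ⬝ᵥ y) ?_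
  have : shiftedForm (Fin.tail a) (Fin.tail v) 1 y =
      ((Fin.tail a ⬝ᵥ y : ℤ) : ℝ) + ∑ i, (Fin.tail a i : ℝ) * Fin.tail v i := by
    simp only [shiftedForm, dotProduct, Int.cast_sum, ← Finset.sum_add_distrib]
    refine Finset.sum_congr rfl fun i _ => ?_
    simp
    ring
  rw [this] at h0
  rw [Fin.sum_univ_succ, hca]
  change (c : ℝ) * v 0 + ∑ i, (Fin.tail a i : ℝ) * Fin.tail v i = _
  push_cast
  rw [← h0]
  field_simp
  ring

/-- The core of reciprocity. For fixed `y` the sum runs over the integers in `[A σ y, B σ y]`, and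
one function `G`, evaluated at `σ • y`, must give its value up to the factor `σ` for both signs. -/
theorem exists_hasSum_boundedGens {n : ℕ} {v : Fin (n + 1) → ℝ}
    {F : ℤ → (Fin (n + 1) → ℤ) → ℝ} (hF : F ∈ boundedGens v) :
    ∃ H ∈ weightAlg (Fin.tail v), ∀ σ, IsGoodSign v σ → ∀ y : Fin n → ℤ,
      HasSum (fun x : ℤ => F σ (Fin.cons x y)) (σ * H σ y) := by
  obtain ⟨e, he, w, hw, a, b, ha, hb, rfl⟩ := hF
  obtain ⟨W, hW, hWw⟩ := hw.exists_antidifference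
  obtain ⟨c, hc⟩ : ∃ c : ℕ, a 0 = c := ⟨(a 0).toNat, by omega⟩
  obtain ⟨k, hk⟩ : ∃ k : ℕ, b 0 = -k := ⟨(-b 0).toNat, by omega⟩
  have hc0 : 0 < c := by omega
  have hk0 : 0 < k := by omega
  have hcR : (0 : ℝ) < c := by exact_mod_cast hc0
  have hkR : (0 : ℝ) < k := by exact_mod_cast hk0
  set v' := Fin.tail v with hv'
  let A : ℤ → (Fin n → ℤ) → ℝ := fun σ y => -(shiftedForm (Fin.tail a) v' σ y) / c - σ * v 0
  let B : ℤ → (Fin n → ℤ) → ℝ := fun σ y => shiftedForm (Fin.tail b) v' σ y / k - σ * v 0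
  have hA : ∀ (σ x : ℤ) y, 0 ≤ shiftedForm a v σ (Fin.cons x y) ↔ A σ y ≤ x := by
    intro σ x y
    rw [shiftedForm_cons, hc]
    simp only [A, sub_le_iff_le_add, div_le_iff₀ hcR]
    push_cast
    constructor <;> intro h <;> linarith
  have hB : ∀ (σ x : ℤ) y, 0 ≤ shiftedForm b v σ (Fin.cons x y) ↔ x ≤ B σ y := by
    intro σ x y
    rw [shiftedForm_cons, hk]
    simp only [B, le_sub_iff_add_le, le_div_iff₀ hkR]
    push_cast
    constructor <;> intro h <;> linarith
  have hAB : ∀ (σ : ℤ) y, 0 ≤ shiftedForm ((k : ℤ) • Fin.tail a + (c : ℤ) • Fin.tail b) v' σ y ↔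
      A σ y ≤ B σ y := by
    intro σ y
    rw [shiftedForm_comb]
    simp only [A, B, sub_le_sub_iff_right, div_le_div_iff₀ hcR hkR]
    push_cast
    constructor <;> intro h <;> linarith
  have hAneg : ∀ y, A (-1) y = -A 1 (-y) := by
    intro y; simp only [A, shiftedForm_neg]; push_cast; ring
  have hBneg : ∀ y, B (-1) y = -B 1 (-y) := by
    intro y; simp only [B, shiftedForm_neg]; push_cast; ring
  -- The telescoped sum for `σ = 1`. As a formula it makes sense also when `B 1 y < A 1 y`, and
  -- those values are the ones used for `σ = -1`.
  let G : (Fin n → ℤ) → ℝ := fun y => W (Fin.cons ⌊B 1 y⌋ y) - W (Fin.cons (⌈A 1 y⌉ - 1) y)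
  have hG : IsQuasiPolyFun G := by
    refine (hW.comp_cons (c := k) hk0 (a := Fin.tail b) ?_).sub
      (hW.comp_cons (c := c) hc0 (a := -Fin.tail a) ?_)
    · intro y r
      simpa only [B, Int.cast_one, one_mul] using floor_quasilinear (Fin.tail b) v' hk0 (v 0) y r
    · intro y r
      have h1 : ∀ y, ⌈A 1 y⌉ = -⌊shiftedForm (Fin.tail a) v' 1 y / c - (-v 0)⌋ := by
        intro y
        rw [← Int.ceil_neg]
        simp only [A]
        congr 1
        ring
      rw [h1, h1, floor_quasilinear _ _ hc0, neg_dotProduct]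
      ring
  refine ⟨e * halfInd ((k : ℤ) • Fin.tail a + (c : ℤ) • Fin.tail b) v' * fun σ y => G (σ • y),
    mul_mem (mul_mem he (halfInd_mem _ _)) (quasiPoly_mem hG), fun σ hσ y => ?_⟩
  have hsum := hasSum_Icc_of_eq_zero (a := ⌈A σ y⌉) (b := ⌊B σ y⌋)
    (f := fun x : ℤ => e σ (Fin.tail (Fin.cons x y : Fin (n + 1) → ℤ)) *
      w (σ • (Fin.cons x y : Fin (n + 1) → ℤ)) *
      halfInd a v σ (Fin.cons x y) * halfInd b v σ (Fin.cons x y)) (by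
    intro x hx
    rcases hx with hx | hx
    · rw [Int.lt_ceil] at hx
      simp [halfInd, hA, not_le.mpr hx]
    · rw [Int.floor_lt] at hx
      simp [halfInd, hB, not_le.mpr hx])
  convert hsum using 1
  have hterm : ∀ x ∈ Finset.Icc ⌈A σ y⌉ ⌊B σ y⌋,
      e σ (Fin.tail (Fin.cons x y : Fin (n + 1) → ℤ)) *
        w (σ • (Fin.cons x y : Fin (n + 1) → ℤ)) *
      halfInd a v σ (Fin.cons x y) * halfInd b v σ (Fin.cons x y) =
      e σ y * w (Fin.cons (σ * x) (σ • y)) := by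
    intro x hx
    rw [Finset.mem_Icc, Int.ceil_le, Int.le_floor] at hx
    have : σ • (Fin.cons x y : Fin (n + 1) → ℤ) = Fin.cons (σ * x) (σ • y) := by
      refine funext fun i => Fin.cases ?_ (fun j => ?_) i <;> simp
    simp [halfInd, hA, hB, hx.1, hx.2, this]
  rw [Finset.sum_congr rfl hterm, ← Finset.mul_sum]
  simp only [Pi.mul_apply, halfInd, hAB]
  by_cases hle : A σ y ≤ B σ y
  · simp only [hle, if_true, mul_one]
    rcases hσ with rfl | ⟨rfl, hgen⟩
    · simp only [one_mul, one_smul, Int.cast_one]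
      rw [sum_Icc_eq_sub (F := fun x => W (Fin.cons x y)) (fun x => hWw x y)]
      have : ⌈A 1 y⌉ - 1 < B 1 y := by
        have := Int.ceil_lt_add_one (A 1 y)
        linarith
      exact Int.le_floor.mpr (by push_cast; exact this.le)
    · have hAn : ∀ m : ℤ, A 1 (-y) ≠ m := fun m => by
        have := shiftedForm_tail_div_not_int hgen (a := a) (c := c) (by omega) hc (-y) m
        simpa [A] using this
      have hBn : ∀ m : ℤ, B 1 (-y) ≠ m := fun m => by
        have := shiftedForm_tail_div_not_int hgen (a := b) (c := -k) (by omega) hk (-y) m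
        simpa [B, neg_div_neg_eq] using this
      have hceil : ∀ z : ℝ, (∀ m : ℤ, z ≠ m) → ⌈z⌉ = ⌊z⌋ + 1 := by
        intro z hz
        rw [Int.ceil_eq_iff]
        constructor
        · push_cast
          rw [add_sub_cancel_right]
          exact lt_of_le_of_ne (Int.floor_le z) (hz _).symm
        · push_cast
          exact (Int.lt_floor_add_one z).le
      -- Under `x ↦ -x` the interval becomes `[B 1 (-y), A 1 (-y)]`. Neither endpoint is an integer,
      -- so each ceiling is the floor plus one, and the sum is `W(⌊A⌋) - W(⌊B⌋) = -G (-y)`.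
      rw [hAneg, hBneg, neg_le_neg_iff] at hle
      have h2 := sum_Icc_neg (fun x => w (Fin.cons x (-y))) ⌈A (-1) y⌉ ⌊B (-1) y⌋
      have h3 := sum_Icc_eq_sub (F := fun x => W (Fin.cons x (-y))) (fun x => hWw x (-y))
        (a := ⌈B 1 (-y)⌉) (b := ⌊A 1 (-y)⌋) (by
          rw [hceil _ hBn, add_sub_cancel_right]
          exact Int.floor_le_floor hle)
      simp only [neg_mul, one_mul, neg_smul, one_smul]
      rw [h2, hAneg, hBneg, Int.floor_neg, Int.ceil_neg, neg_neg, neg_neg, h3, hceil _ hBn,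
        add_sub_cancel_right]
      simp only [G]
      rw [hceil _ hAn, add_sub_cancel_right]
      push_cast
      ring
  · have : Finset.Icc ⌈A σ y⌉ ⌊B σ y⌋ = ∅ := by
      refine Finset.Icc_eq_empty fun h => hle ?_
      rw [Int.ceil_le] at h
      exact h.trans (Int.floor_le _)
    simp [hle, this]

theorem exists_hasSum_span {n : ℕ} {v : Fin (n + 1) → ℝ}
    {F : ℤ → (Fin (n + 1) → ℤ) → ℝ} (hF : F ∈ Submodule.span ℝ (boundedGens v)) :
    ∃ H ∈ weightAlg (Fin.tail v), ∀ σ, IsGoodSign v σ → ∀ y : Fin n → ℤ,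
      HasSum (fun x : ℤ => F σ (Fin.cons x y)) (σ * H σ y) := by
  induction hF using Submodule.span_induction with
  | mem F hF => exact exists_hasSum_boundedGens hF
  | zero => exact ⟨0, zero_mem _, fun σ _ y => by simp⟩
  | add F G _ _ hF hG =>
    obtain ⟨H, hH, h⟩ := hF
    obtain ⟨K, hK, k⟩ := hG
    refine ⟨H + K, add_mem hH hK, fun σ hσ y => ?_⟩
    simpa [mul_add] using (h σ hσ y).add (k σ hσ y)
  | smul r F _ hF =>
    obtain ⟨H, hH, h⟩ := hF
    refine ⟨r • H, Subalgebra.smul_mem _ hH r, fun σ hσ y => ?_⟩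
    simpa [mul_left_comm] using (h σ hσ y).mul_left r

/-- Summation over one variable that is bounded below and above. -/
theorem exists_hasSum_of_bounds {n : ℕ} {v : Fin (n + 1) → ℝ}
    {f : ℤ → (Fin (n + 1) → ℤ) → ℝ} (hf : f ∈ weightAlg v) {a b : Fin (n + 1) → ℤ}
    (ha : 0 < a 0) (hb : b 0 < 0) :
    ∃ H ∈ weightAlg (Fin.tail v), ∀ σ, IsGoodSign v σ → ∀ y : Fin n → ℤ,
      HasSum (fun x : ℤ => (f * (halfInd a v * halfInd b v)) σ (Fin.cons x y)) (σ * H σ y) := by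
  refine exists_hasSum_span (mul_mem_span_boundedGens hf _ (Submodule.subset_span
    ⟨1, one_mem _, fun _ => 1, .const 1, a, b, ha, hb, ?_⟩))
  ext σ y
  simp

/-! ### Summation over all variables but the last -/

/-- The product of the indicators of the half-spaces `|y_i| ≤ M t`, where `t` is the last
variable. -/
def boxInd {n : ℕ} (M : ℤ) (v : Fin (n + 1) → ℝ) : ℤ → (Fin (n + 1) → ℤ) → ℝ :=
  ∏ i : Fin n, (halfInd (Fin.snoc (Pi.single i 1) M : Fin (n + 1) → ℤ) v *
    halfInd (Fin.snoc (Pi.single i (-1)) M : Fin (n + 1) → ℤ) v)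

theorem shiftedForm_snoc {n : ℕ} (a : Fin n → ℤ) (b : ℤ) (v : Fin (n + 1) → ℝ) (σ t : ℤ)
    (z : Fin n → ℤ) : shiftedForm (Fin.snoc a b : Fin (n + 1) → ℤ) v σ (Fin.snoc z t) =
      ∑ i, (a i : ℝ) * (z i + σ * v i.castSucc) + b * (t + σ * v (Fin.last n)) := by
  simp [shiftedForm, Fin.sum_univ_castSucc]

theorem shiftedForm_snoc_single {n : ℕ} (i : Fin n) (s M : ℤ) (v : Fin (n + 1) → ℝ) (σ t : ℤ)
    (z : Fin n → ℤ) :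
    shiftedForm (Fin.snoc (Pi.single i s) M : Fin (n + 1) → ℤ) v σ (Fin.snoc z t) =
      s * (z i + σ * v i.castSucc) + M * (t + σ * v (Fin.last n)) := by
  rw [shiftedForm_snoc, Finset.sum_eq_single i] <;> simp +contextual

theorem tail_snoc_single_succ {n : ℕ} (i : Fin n) (s M : ℤ) :
    Fin.tail (Fin.snoc (Pi.single i.succ s) M : Fin (n + 2) → ℤ) =
      (Fin.snoc (Pi.single i s) M : Fin (n + 1) → ℤ) := by
  refine funext fun j => Fin.lastCases ?_ (fun k => ?_) j
  · simp only [Fin.tail, Fin.succ_last, Fin.snoc_last]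
  · simp only [Fin.tail, Fin.succ_castSucc, Fin.snoc_castSucc, Pi.single_apply, Fin.succ_inj]

theorem snoc_single_zero {n : ℕ} (i : Fin (n + 1)) (s M : ℤ) :
    (Fin.snoc (Pi.single i s) M : Fin (n + 2) → ℤ) 0 = if i = 0 then s else 0 := by
  rw [← Fin.castSucc_zero, Fin.snoc_castSucc, Pi.single_apply]
  simp [eq_comm]

theorem boxInd_succ {n : ℕ} (M : ℤ) (v : Fin (n + 2) → ℝ) (σ : ℤ) (y : Fin (n + 2) → ℤ) :
    boxInd M v σ y = (halfInd (Fin.snoc (Pi.single 0 1) M : Fin (n + 2) → ℤ) v *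
      halfInd (Fin.snoc (Pi.single 0 (-1)) M : Fin (n + 2) → ℤ) v) σ y *
      boxInd M (Fin.tail v) σ (Fin.tail y) := by
  simp only [boxInd]
  rw [Fin.prod_univ_succ]
  simp only [Pi.mul_apply, Finset.prod_apply]
  congr 1
  refine Finset.prod_congr rfl fun i _ => ?_
  have h : ∀ s : ℤ, (Fin.snoc (Pi.single i.succ s) M : Fin (n + 2) → ℤ) 0 = 0 := fun s => by
    rw [snoc_single_zero]; simp
  rw [halfInd_of_zero (h 1), halfInd_of_zero (h (-1)), tail_snoc_single_succ, tail_snoc_single_succ]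

theorem boxInd_eq {n : ℕ} (M : ℤ) (v : Fin (n + 1) → ℝ) (σ t : ℤ) (z : Fin n → ℤ) [Decidable
    (∀ i, |z i + σ * v i.castSucc| ≤ M * (t + σ * v (Fin.last n)))] :
    boxInd M v σ (Fin.snoc z t) =
      if ∀ i, |z i + σ * v i.castSucc| ≤ M * (t + σ * v (Fin.last n)) then 1 else 0 := by
  have h : ∀ i, (halfInd (Fin.snoc (Pi.single i 1) M : Fin (n + 1) → ℤ) v *
    halfInd (Fin.snoc (Pi.single i (-1)) M : Fin (n + 1) → ℤ) v) σ (Fin.snoc z t) =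
      if |z i + σ * v i.castSucc| ≤ M * (t + σ * v (Fin.last n)) then 1 else 0 := by
    intro i
    simp only [Pi.mul_apply, halfInd, shiftedForm_snoc_single, abs_le, ite_zero_mul_ite_zero,
      mul_one]
    refine if_congr ?_ rfl rfl
    push_cast
    constructor <;> rintro ⟨h1, h2⟩ <;> constructor <;> linarith
  simp only [boxInd, Finset.prod_apply, h]
  rw [Finset.prod_ite_zero]
  simp

theorem finite_boxInd_ne_zero {n : ℕ} (M : ℤ) (v : Fin (n + 1) → ℝ) (σ t : ℤ) :
    {z : Fin n → ℤ | boxInd M v σ (Fin.snoc z t) ≠ 0}.Finite := by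
  classical
  set K : ℝ := M * (t + σ * v (Fin.last n))
  refine Set.Finite.subset (Set.finite_Icc (fun i => ⌈-K - σ * v i.castSucc⌉ : Fin n → ℤ)
    (fun i => ⌊K - σ * v i.castSucc⌋)) fun z hz => ?_
  rw [Set.mem_ofPred_eq, boxInd_eq, ite_ne_right_iff] at hz
  refine ⟨fun i => ?_, fun i => ?_⟩
  · have := (abs_le.mp (hz.1 i)).1
    rw [Int.ceil_le]
    linarith
  · have := (abs_le.mp (hz.1 i)).2
    rw [Int.le_floor]
    linarith

/-- Induction on the number of summed variables, each contributing one factor `σ`. The box supplies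
the lower and upper bound required for variable `0`, and its remaining factors do not involve that
variable. Finite support justifies the iterated sum. -/
theorem exists_hasSum_box {n : ℕ} (M : ℤ) (v : Fin (n + 1) → ℝ)
    {f : ℤ → (Fin (n + 1) → ℤ) → ℝ} (hf : f ∈ weightAlg v) :
    ∃ H ∈ weightAlg (fun _ : Fin 1 => v (Fin.last n)), ∀ σ, IsGoodSign v σ → ∀ t : ℤ,
      HasSum (fun z : Fin n → ℤ => (f * boxInd M v) σ (Fin.snoc z t))
        ((σ : ℝ) ^ n * H σ (fun _ => t)) := by
  induction n with
  | zero =>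
    have hv : (fun _ : Fin 1 => v (Fin.last 0)) = v := funext fun i => by
      rw [Subsingleton.elim i (Fin.last 0)]
    rw [hv]
    refine ⟨f, hf, fun σ _ t => ?_⟩
    have h := hasSum_unique (fun z : Fin 0 → ℤ => (f * boxInd M v) σ (Fin.snoc z t))
    convert h using 1
    have ht : (fun _ : Fin 1 => t) = (Fin.snoc (fun _ => 0 : Fin 0 → ℤ) t : Fin 1 → ℤ) :=
      funext fun i => by rw [Subsingleton.elim i (Fin.last 0), Fin.snoc_last]
    simp only [ht, boxInd, Finset.univ_eq_empty, Finset.prod_empty, mul_one, pow_zero, one_mul]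
    exact congrArg (fun z : Fin 0 → ℤ => f σ (Fin.snoc z t)) (Subsingleton.elim _ _)
  | succ n ih =>
    obtain ⟨H₀, hH₀, h₀⟩ := exists_hasSum_of_bounds hf
      (a := (Fin.snoc (Pi.single 0 1) M : Fin (n + 2) → ℤ))
      (b := (Fin.snoc (Pi.single 0 (-1)) M : Fin (n + 2) → ℤ))
      (by rw [snoc_single_zero]; simp) (by rw [snoc_single_zero]; simp)
    obtain ⟨H, hH, h⟩ := ih (Fin.tail v) hH₀
    refine ⟨H, by simpa [Fin.tail] using hH, fun σ hσ t => ?_⟩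
    have hsum : Summable (fun z : Fin (n + 1) → ℤ => (f * boxInd M v) σ (Fin.snoc z t)) := by
      refine summable_of_hasFiniteSupport ((finite_boxInd_ne_zero M v σ t).subset fun z hz => ?_)
      exact right_ne_zero_of_mul hz
    let e : (Fin n → ℤ) × ℤ ≃ (Fin (n + 1) → ℤ) :=
      (Equiv.prodComm _ _).trans (Fin.consEquiv (fun _ : Fin (n + 1) => ℤ))
    have htot := (e.hasSum_iff (f := fun z => (f * boxInd M v) σ (Fin.snoc z t))).mpr hsum.hasSum
    have hfib : ∀ z : Fin n → ℤ, HasSum (fun x : ℤ => ((fun z =>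
        (f * boxInd M v) σ (Fin.snoc z t)) ∘ e) (z, x))
        (σ * (H₀ * boxInd M (Fin.tail v)) σ (Fin.snoc z t)) := by
      intro z
      have := (h₀ σ hσ (Fin.snoc z t)).mul_right (boxInd M (Fin.tail v) σ (Fin.snoc z t))
      have hval : (σ : ℝ) * (H₀ * boxInd M (Fin.tail v)) σ (Fin.snoc z t) =
          σ * H₀ σ (Fin.snoc z t) * boxInd M (Fin.tail v) σ (Fin.snoc z t) := by
        simp only [Pi.mul_apply]
        ring
      rw [hval]
      refine this.congr_fun fun x => ?_
      change (f * boxInd M v) σ (Fin.snoc (Fin.cons x z : Fin (n + 1) → ℤ) t) = _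
      simp only [Pi.mul_apply, ← Fin.cons_snoc_eq_snoc_cons, boxInd_succ, Fin.tail_cons]
      ring
    have h1 := htot.prod_fiberwise hfib
    have h2 := (h σ hσ.tail t).mul_left (σ : ℝ)
    have h3 := h1.unique h2
    rw [pow_succ', mul_assoc, ← h3]
    exact hsum.hasSum

/-- Elements of the algebra in one variable `t` agree with a quasipolynomial for `t ≥ 1`. -/
theorem exists_quasiPoly_of_mem_weightAlg {v : Fin 1 → ℝ} (hv : 0 ≤ v 0) (hv1 : v 0 < 1)
    {f : ℤ → (Fin 1 → ℤ) → ℝ} (hf : f ∈ weightAlg v) :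
    ∃ q : (Fin 1 → ℤ) → ℝ, IsQuasiPolyFun q ∧ ∀ σ : ℤ, (σ = 1 ∨ σ = -1) → ∀ y : Fin 1 → ℤ,
      1 ≤ y 0 → f σ y = q (σ • y) := by
  refine Algebra.adjoin_induction ?_ ?_ ?_ ?_ hf
  · rintro g (⟨a, rfl⟩ | ⟨w, hw, rfl⟩)
    · refine ⟨fun _ => if 0 ≤ a 0 then 1 else 0, .const _, fun σ hσ y hy => ?_⟩
      have hy' : (1 : ℝ) ≤ y 0 := by exact_mod_cast hy
      -- As the shift lies in `[0, 1)`, the shifted variable stays positive for `y 0 ≥ 1`, so the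
      -- indicator depends only on the sign of the coefficient.
      have hpos : 0 < y 0 + σ * v 0 := by
        rcases hσ with rfl | rfl <;> push_cast <;> linarith
      simp only [halfInd, shiftedForm, Finset.univ_unique, Fin.default_eq_zero,
        Finset.sum_singleton]
      refine if_congr ?_ rfl rfl
      rw [mul_nonneg_iff_of_pos_right hpos]
      exact_mod_cast Iff.rfl
    · exact ⟨w, hw, fun _ _ _ _ => rfl⟩
  · exact fun r => ⟨fun _ => r, .const r, fun _ _ _ _ => rfl⟩
  · rintro f g _ _ ⟨p, hp, h⟩ ⟨q, hq, k⟩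
    refine ⟨_, hp.add hq, fun σ hσ y hy => ?_⟩
    simp [h σ hσ y hy, k σ hσ y hy]
  · rintro f g _ _ ⟨p, hp, h⟩ ⟨q, hq, k⟩
    refine ⟨_, hp.mul hq, fun σ hσ y hy => ?_⟩
    simp [h σ hσ y hy, k σ hσ y hy]

/-- Functions on `ℤ` that are polynomial on each residue class modulo some `M > 0`. -/
def IsQuasiPoly (f : ℤ → ℝ) : Prop :=
  ∃ M : ℕ, 0 < M ∧ ∀ r : ℤ, ∃ p : Polynomial ℝ, ∀ t : ℤ, f (M * t + r) = p.eval (t : ℝ)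

theorem IsQuasiPolyFun.isQuasiPoly {q : (Fin 1 → ℤ) → ℝ} (hq : IsQuasiPolyFun q) :
    IsQuasiPoly (fun t => q (fun _ => t)) := by
  obtain ⟨M, hM, h⟩ := hq
  refine ⟨M, hM, fun r => ?_⟩
  obtain ⟨p, hp⟩ := h (fun _ => r)
  refine ⟨MvPolynomial.aeval (fun _ => Polynomial.X) p, fun t => ?_⟩
  have h1 := hp (fun _ => t)
  have h2 : Polynomial.eval (t : ℝ) (MvPolynomial.aeval (fun _ => Polynomial.X) p) =
      MvPolynomial.eval (fun _ => (t : ℝ)) p := by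
    rw [← Polynomial.coe_aeval_eq_eval, ← MvPolynomial.coe_aeval_eq_eval, ← AlgHom.comp_apply, MvPolynomial.comp_aeval]
    simp
  rw [h2, ← h1]
  rfl

/-- The number of integer points of a bounded polyhedron with parameter `t` is a quasipolynomial,
with a reciprocity law if the shift vector is generic. -/
theorem exists_quasiPoly_ncard {n : ℕ} (Z : Finset (Fin (n + 1) → ℤ)) (v : Fin (n + 1) → ℝ)
    (hv : 0 ≤ v (Fin.last n)) (hv1 : v (Fin.last n) < 1) (M : ℤ)
    (hM : ∀ σ, IsGoodSign v σ → ∀ t : ℤ, 1 ≤ t → ∀ z : Fin n → ℤ,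
      (∀ a ∈ Z, 0 ≤ shiftedForm a v σ (Fin.snoc z t)) →
        ∀ i, |z i + σ * v i.castSucc| ≤ M * (t + σ * v (Fin.last n))) :
    ∃ q : ℤ → ℝ, IsQuasiPoly q ∧ ∀ σ, IsGoodSign v σ → ∀ t : ℤ, 1 ≤ t →
      ({z : Fin n → ℤ | ∀ a ∈ Z, 0 ≤ shiftedForm a v σ (Fin.snoc z t)}.ncard : ℝ) =
        (σ : ℝ) ^ n * q (σ * t) := by
  classical
  have hf : (∏ a ∈ Z, halfInd a v) ∈ weightAlg v := Subalgebra.prod_mem _ fun a _ => halfInd_mem a v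
  obtain ⟨H, hH, h⟩ := exists_hasSum_box M v hf
  obtain ⟨q, hq, h'⟩ := exists_quasiPoly_of_mem_weightAlg hv hv1 hH
  refine ⟨_, hq.isQuasiPoly, fun σ hσ t ht => ?_⟩
  have hσ' : σ = 1 ∨ σ = -1 := hσ.imp id And.left
  have h1 := h σ hσ t
  rw [h' σ hσ' _ ht] at h1
  have hval : ∀ z : Fin n → ℤ, ((∏ a ∈ Z, halfInd a v) * boxInd M v) σ (Fin.snoc z t) =
      if z ∈ {z : Fin n → ℤ | ∀ a ∈ Z, 0 ≤ shiftedForm a v σ (Fin.snoc z t)} then 1 else 0 := by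
    intro z
    simp only [Pi.mul_apply, Finset.prod_apply, halfInd, Finset.prod_ite_zero, boxInd_eq,
      Set.mem_ofPred_eq, ite_zero_mul_ite_zero, mul_one, Finset.prod_const_one]
    exact if_congr ⟨And.left, fun hz => ⟨hz, hM σ hσ t ht z hz⟩⟩ rfl rfl
  have hfin : {z : Fin n → ℤ | ∀ a ∈ Z, 0 ≤ shiftedForm a v σ (Fin.snoc z t)}.Finite := by
    refine (finite_boxInd_ne_zero M v σ t).subset fun z hz => ?_
    have := hval z
    rw [if_pos hz] at this
    exact right_ne_zero_of_mul (ne_of_eq_of_ne this one_ne_zero)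
  simp only [hval] at h1
  have h2 := hasSum_sum_of_ne_finset_zero (L := .unconditional _) (s := hfin.toFinset) (f := fun z : Fin n → ℤ =>
    if z ∈ {z : Fin n → ℤ | ∀ a ∈ Z, 0 ≤ shiftedForm a v σ (Fin.snoc z t)} then (1 : ℝ) else 0)
    fun z hz => if_neg (by simpa using hz)
  have h3 := h1.unique h2
  rw [Finset.sum_congr rfl (fun z hz => if_pos (hfin.mem_toFinset.mp hz))] at h3
  rw [Set.ncard_eq_toFinset_card _ hfin]
  simp only [Finset.sum_const, nsmul_eq_mul, mul_one] at h3
  rw [← h3]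
  congr 2

/-! ### Ehrhart reciprocity for polyhedra with integral inequalities -/

/-- Moving a little from `x` in the direction `a` stays in `P` but raises the functional by a
positive multiple of `a ⬝ᵥ a`. -/
theorem eq_zero_of_mem_interior {d : ℕ} {P : Set (Fin d → ℝ)} {a : Fin d → ℝ} {b : ℝ}
    (h : ∀ x ∈ P, a ⬝ᵥ x ≤ b) {x : Fin d → ℝ} (hx : x ∈ interior P) (hxb : a ⬝ᵥ x = b) : a = 0 := by
  have hc : Continuous (fun ε : ℝ => x + ε • a) := by fun_prop
  have hnhds : ∀ᶠ ε in nhdsWithin (0 : ℝ) (Set.Ioi 0), x + ε • a ∈ P := by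
    refine nhdsWithin_le_nhds (hc.continuousAt.eventually (?_ : ∀ᶠ z in nhds (x + (0 : ℝ) • a), z ∈ P))
    simpa using mem_interior_iff_mem_nhds.mp hx
  obtain ⟨ε, hε, hε0⟩ := (hnhds.and self_mem_nhdsWithin).exists
  have h1 := h _ hε
  rw [dotProduct_add, dotProduct_smul, hxb, smul_eq_mul] at h1
  have hε0' : (0 : ℝ) < ε := hε0
  have h2 : a ⬝ᵥ a ≤ 0 := by
    by_contra h3
    push Not at h3
    have := mul_pos hε0' h3
    linarith
  have h3 : a ⬝ᵥ a = 0 := le_antisymm h2 (Finset.sum_nonneg fun i _ => mul_self_nonneg _)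
  exact dotProduct_self_eq_zero.mp h3

theorem interior_polyhedron {d : ℕ} {ι : Type*} (H : Finset ι) (a : ι → Fin d → ℝ) (b : ι → ℝ)
    (ha : ∀ h ∈ H, a h ≠ 0) :
    interior {x : Fin d → ℝ | ∀ h ∈ H, a h ⬝ᵥ x ≤ b h} = {x | ∀ h ∈ H, a h ⬝ᵥ x < b h} := by
  refine Set.Subset.antisymm (fun x hx h hh => ?_) (interior_maximal (fun x hx h hh => (hx h hh).le) ?_)
  · refine lt_of_le_of_ne (interior_subset hx h hh) fun heq => ha h hh ?_
    exact eq_zero_of_mem_interior (P := {x : Fin d → ℝ | ∀ h ∈ H, a h ⬝ᵥ x ≤ b h})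
      (fun y hy => hy h hh) hx heq
  · have : {x : Fin d → ℝ | ∀ h ∈ H, a h ⬝ᵥ x < b h} = ⋂ h ∈ H, {x | a h ⬝ᵥ x < b h} := by
      ext x; simp
    rw [this]
    refine isOpen_biInter_finset fun h _ => ?_
    have hc : Continuous fun x : Fin d → ℝ => a h ⬝ᵥ x := by
      simp only [dotProduct]
      fun_prop
    exact isOpen_lt hc continuous_const

/-- Vectors at which no integral linear form takes an integral value are dense. -/
theorem dense_generic (n : ℕ) : Dense {v : Fin n → ℝ | ∀ a : Fin n → ℤ, a ≠ 0 → ∀ m : ℤ,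
    ∑ i, (a i : ℝ) * v i ≠ m} := by
  have h : Dense (⋂ k : {a : Fin n → ℤ // a ≠ 0} × ℤ,
      {v : Fin n → ℝ | ∑ i, (k.1.1 i : ℝ) * v i = k.2}ᶜ) := by
    -- Baire: only countably many hyperplanes are removed, each closed with empty interior.
    refine dense_iInter_of_isOpen (fun k => ?_) (fun k => ?_)
    · rw [isOpen_compl_iff]
      exact isClosed_eq (by fun_prop) continuous_const
    · rw [← interior_eq_empty_iff_dense_compl, Set.eq_empty_iff_forall_notMem]
      intro v hv
      refine k.1.2 (funext fun i => ?_)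
      have hv' : v ∈ {v : Fin n → ℝ | ∑ i, (k.1.1 i : ℝ) * v i = k.2} := interior_subset hv
      have h0 := eq_zero_of_mem_interior (a := fun i => (k.1.1 i : ℝ)) (b := (k.2 : ℝ))
        (fun y hy => le_of_eq hy) hv hv'
      simpa using congrFun h0 i
  refine h.mono fun v hv a ha m => ?_
  rw [Set.mem_iInter] at hv
  exact hv (⟨a, ha⟩, m)

/-- A polyhedron that is cut out by linear inequalities with integral coefficients. -/
def IsIntegralPolyhedron {d : ℕ} (P : Set (Fin d → ℝ)) : Prop :=
  ∃ H : Finset ((Fin d → ℤ) × ℤ), P = {x | ∀ h ∈ H, (fun i => (h.1 i : ℝ)) ⬝ᵥ x ≤ h.2}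

theorem IsIntegralPolyhedron.inter {d : ℕ} {P P' : Set (Fin d → ℝ)} (h : IsIntegralPolyhedron P)
    (h' : IsIntegralPolyhedron P') : IsIntegralPolyhedron (P ∩ P') := by
  classical
  obtain ⟨H, rfl⟩ := h
  obtain ⟨H', rfl⟩ := h'
  refine ⟨H ∪ H', ?_⟩
  ext x
  simp only [Set.mem_inter_iff, Set.mem_ofPred_eq, Finset.mem_union, or_imp, forall_and]

theorem dotProduct_latticePoint {d : ℕ} (a z : Fin d → ℤ) (t : ℕ) :
    (fun i => (a i : ℝ)) ⬝ᵥ latticePoint t z = ((a ⬝ᵥ z : ℤ) : ℝ) / t := by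
  simp only [dotProduct, latticePoint, Int.cast_sum, Finset.sum_div]
  refine Finset.sum_congr rfl fun i _ => ?_
  push_cast
  ring

/-- The value at `v` of the linear form `b t - a ⬝ x` in the variables `(x, t)`. -/
def slackAt {d : ℕ} (h : (Fin d → ℤ) × ℤ) (v : Fin (d + 1) → ℝ) : ℝ :=
  h.2 * v (Fin.last d) - ∑ i, (h.1 i : ℝ) * v i.castSucc

/-- The linear form `b t - a ⬝ x` in the variables `(x, t)`. -/
def slackForm {d : ℕ} (h : (Fin d → ℤ) × ℤ) : Fin (d + 1) → ℤ := Fin.snoc (-h.1) h.2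

theorem shiftedForm_slackForm {d : ℕ} (h : (Fin d → ℤ) × ℤ) (v : Fin (d + 1) → ℝ) (σ t : ℤ)
    (z : Fin d → ℤ) : shiftedForm (slackForm h) v σ (Fin.snoc z t) =
      ((h.2 * t - h.1 ⬝ᵥ z : ℤ) : ℝ) + σ * slackAt h v := by
  rw [slackForm, shiftedForm_snoc]
  simp only [slackAt, dotProduct, mul_add, mul_sub, Finset.sum_add_distrib, Finset.mul_sum]
  push_cast
  simp only [Pi.neg_apply, Int.cast_neg, neg_mul, Finset.sum_neg_distrib, mul_left_comm (σ : ℝ)]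
  ring

/-- The shift changes the integer `b t - a ⬝ z` by `σ` times a number in `[0, 1)`. For `σ = 1` this
does not affect being `≥ 0`; for `σ = -1` and positive slack, `≥ 0` after the shift means `> 0`
before it. -/
theorem exists_ehrhart_of_shift {d : ℕ} (H : Finset ((Fin d → ℤ) × ℤ))
    (hb : Bornology.IsBounded {x : Fin d → ℝ | ∀ h ∈ H, (fun i => (h.1 i : ℝ)) ⬝ᵥ x ≤ h.2})
    (v : Fin (d + 1) → ℝ) (hv : 0 ≤ v (Fin.last d)) (hv1 : v (Fin.last d) < 1)
    (hH : ∀ h ∈ H, 0 ≤ slackAt h v ∧ slackAt h v < 1) :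
    ∃ q : ℤ → ℝ, IsQuasiPoly q ∧
      (∀ t : ℕ, 0 < t → q t =
        ehr {x : Fin d → ℝ | ∀ h ∈ H, (fun i => (h.1 i : ℝ)) ⬝ᵥ x ≤ h.2} t) ∧
      (IsGoodSign v (-1) → (∀ h ∈ H, 0 < slackAt h v) → ∀ t : ℕ, 0 < t → (-1 : ℝ) ^ d * q (-t) =
        ehr {x : Fin d → ℝ | ∀ h ∈ H, (fun i => (h.1 i : ℝ)) ⬝ᵥ x < h.2} t) := by
  classical
  obtain ⟨R, hR⟩ := hb.exists_norm_le
  obtain ⟨q, hq, hq'⟩ := exists_quasiPoly_ncard (H.image slackForm) v hv hv1 ⌈R⌉ (by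
    intro σ hσ t ht z hz i
    have ht' : (1 : ℝ) ≤ t := by exact_mod_cast ht
    have hpos : 0 < t + σ * v (Fin.last d) := by
      rcases hσ with rfl | ⟨rfl, -⟩ <;> push_cast <;> linarith
    -- A shifted solution, rescaled to height one, lies in the bounded polyhedron; this gives the
    -- box bound.
    have hmem : (fun i => (z i + σ * v i.castSucc) / (t + σ * v (Fin.last d))) ∈
        {x : Fin d → ℝ | ∀ h ∈ H, (fun i => (h.1 i : ℝ)) ⬝ᵥ x ≤ h.2} := by
      intro h hh
      have h1 := hz _ (Finset.mem_image_of_mem _ hh)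
      rw [slackForm, shiftedForm_snoc] at h1
      simp only [dotProduct, ← mul_div_assoc]
      rw [← Finset.sum_div, div_le_iff₀ hpos]
      simp only [Pi.neg_apply, Int.cast_neg, neg_mul, Finset.sum_neg_distrib] at h1
      linarith
    have h1 := (norm_le_pi_norm _ i).trans (hR _ hmem)
    rw [Real.norm_eq_abs, abs_div, abs_of_pos hpos, div_le_iff₀ hpos] at h1
    exact h1.trans (mul_le_mul_of_nonneg_right (Int.le_ceil R) hpos.le))
  refine ⟨q, hq, fun t ht => ?_, fun hgood hpos t ht => ?_⟩
  · have h1 := hq' 1 (Or.inl rfl) t (by omega)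
    simp only [Int.cast_one, one_pow, one_mul] at h1
    rw [← h1, ehr]
    congr 2
    ext z
    simp only [Set.mem_ofPred_eq, Finset.forall_mem_image, dotProduct_latticePoint]
    refine forall₂_congr fun h hh => ?_
    have ht' : (0 : ℝ) < t := by exact_mod_cast ht
    rw [shiftedForm_slackForm, div_le_iff₀ ht']
    have h2 := hH h hh
    have h3 : ((h.1 ⬝ᵥ z : ℤ) : ℝ) ≤ h.2 * t ↔ (0 : ℤ) ≤ h.2 * t - h.1 ⬝ᵥ z := by
      rw [sub_nonneg]; exact_mod_cast Iff.rfl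
    rw [h3]
    constructor
    · intro h4
      by_contra h5
      have : h.2 * t - h.1 ⬝ᵥ z ≤ -1 := by omega
      have : ((h.2 * t - h.1 ⬝ᵥ z : ℤ) : ℝ) ≤ -1 := by exact_mod_cast this
      rw [Int.cast_one, one_mul] at h4
      linarith
    · intro h4
      have : (0 : ℝ) ≤ ((h.2 * t - h.1 ⬝ᵥ z : ℤ) : ℝ) := by exact_mod_cast h4
      rw [Int.cast_one, one_mul]
      linarith
  · have h1 := hq' (-1) hgood t (by omega)
    simp only [Int.cast_neg, Int.cast_one, neg_mul, one_mul] at h1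
    rw [← h1, ehr]
    congr 2
    ext z
    simp only [Set.mem_ofPred_eq, Finset.forall_mem_image, dotProduct_latticePoint]
    refine forall₂_congr fun h hh => ?_
    have ht' : (0 : ℝ) < t := by exact_mod_cast ht
    rw [shiftedForm_slackForm, div_lt_iff₀ ht']
    have h2 := hH h hh
    have h2' := hpos h hh
    have h3 : ((h.1 ⬝ᵥ z : ℤ) : ℝ) < h.2 * t ↔ (0 : ℤ) < h.2 * t - h.1 ⬝ᵥ z := by
      rw [sub_pos]; exact_mod_cast Iff.rfl
    rw [h3]
    constructor
    · intro h4
      by_contra h5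
      have : h.2 * t - h.1 ⬝ᵥ z ≤ 0 := by omega
      have : ((h.2 * t - h.1 ⬝ᵥ z : ℤ) : ℝ) ≤ 0 := by exact_mod_cast this
      push_cast at h4 this
      linarith
    · intro h4
      have : (1 : ℝ) ≤ ((h.2 * t - h.1 ⬝ᵥ z : ℤ) : ℝ) := by exact_mod_cast h4
      push_cast at this ⊢
      linarith

theorem exists_generic_shift {d : ℕ} (H : Finset ((Fin d → ℤ) × ℤ)) {p : Fin d → ℝ}
    (hp : ∀ h ∈ H, (fun i => (h.1 i : ℝ)) ⬝ᵥ p < h.2) :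
    ∃ v : Fin (d + 1) → ℝ, 0 < v (Fin.last d) ∧ v (Fin.last d) < 1 ∧ IsGoodSign v (-1) ∧
      ∀ h ∈ H, 0 < slackAt h v ∧ slackAt h v < 1 := by
  let U : Set (Fin (d + 1) → ℝ) := {v | 0 < v (Fin.last d)} ∩ {v | v (Fin.last d) < 1} ∩
    ⋂ h ∈ H, ({v | 0 < slackAt h v} ∩ {v | slackAt h v < 1})
  have hU : IsOpen U := by
    refine ((isOpen_lt continuous_const (by fun_prop)).inter
      (isOpen_lt (by fun_prop) continuous_const)).inter (isOpen_biInter_finset fun h _ => ?_)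
    have hc : Continuous (slackAt h) := by unfold slackAt; fun_prop
    exact (isOpen_lt continuous_const hc).inter (isOpen_lt hc continuous_const)
  let g : (Fin d → ℤ) × ℤ → ℝ := fun h => h.2 - (fun i => (h.1 i : ℝ)) ⬝ᵥ p
  have hg : ∀ h ∈ H, 0 < g h := fun h hh => sub_pos.mpr (hp h hh)
  have hs : 0 ≤ ∑ h ∈ H, g h := Finset.sum_nonneg fun h hh => (hg h hh).le
  -- Small enough that both the height `ε` and every slack `ε * g h` of the vector `ε (p, 1)` are
  -- below `1`. The conditions are open, so a generic vector nearby satisfies them too.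
  set ε : ℝ := (2 + ∑ h ∈ H, g h)⁻¹ with hε
  have hε0 : 0 < ε := by positivity
  have hUne : U.Nonempty := by
    have hslack : ∀ h, slackAt h (Fin.snoc (ε • p) ε : Fin (d + 1) → ℝ) = ε * g h := by
      intro h
      simp only [slackAt, g, Fin.snoc_last, Fin.snoc_castSucc, Pi.smul_apply, smul_eq_mul, dotProduct,
        mul_sub, Finset.mul_sum, mul_left_comm]
      ring
    refine ⟨Fin.snoc (ε • p) ε, ⟨?_, ?_⟩, ?_⟩
    · simpa using hε0
    · simp only [Set.mem_ofPred_eq, Fin.snoc_last]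
      exact inv_lt_one_of_one_lt₀ (by linarith)
    · simp only [Set.mem_iInter, Set.mem_inter_iff, Set.mem_ofPred_eq, hslack]
      refine fun h hh => ⟨mul_pos hε0 (hg h hh), ?_⟩
      rw [hε, inv_mul_lt_iff₀ (by linarith)]
      have := Finset.single_le_sum (f := g) (fun h hh => (hg h hh).le) hh
      linarith
  obtain ⟨v, hvU, hv⟩ := (dense_generic (d + 1)).inter_open_nonempty U hU hUne
  refine ⟨v, hvU.1.1, hvU.1.2, Or.inr ⟨rfl, hv⟩, fun h hh => ?_⟩
  have := hvU.2
  simp only [Set.mem_iInter] at this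
  exact this h hh

/-- Ehrhart's theorem and Ehrhart-Macdonald reciprocity. -/
theorem exists_ehrhart {d : ℕ} {P : Set (Fin d → ℝ)} (hP : IsIntegralPolyhedron P)
    (hb : Bornology.IsBounded P) :
    ∃ q : ℤ → ℝ, IsQuasiPoly q ∧ (∀ t : ℕ, 0 < t → q t = ehr P t) ∧
      ((interior P).Nonempty → ∀ t : ℕ, 0 < t → (-1 : ℝ) ^ d * q (-t) = ehr (interior P) t) := by
  classical
  obtain ⟨H, rfl⟩ := hP
  by_cases hne : (interior {x : Fin d → ℝ | ∀ h ∈ H, (fun i => (h.1 i : ℝ)) ⬝ᵥ x ≤ h.2}).Nonempty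
  · obtain ⟨p, hp⟩ := hne
    -- Inequalities with zero normal hold everywhere, since `P` is non-empty, but might read `0 ≤
    -- 0`, whose strict form fails; they are dropped before the interior is described by strict
    -- inequalities.
    let H' := H.filter (fun h => (fun i => (h.1 i : ℝ)) ≠ (0 : Fin d → ℝ))
    have hHH' : {x : Fin d → ℝ | ∀ h ∈ H, (fun i => (h.1 i : ℝ)) ⬝ᵥ x ≤ h.2} =
        {x | ∀ h ∈ H', (fun i => (h.1 i : ℝ)) ⬝ᵥ x ≤ h.2} := by
      ext x
      refine ⟨fun hx h hh => hx h (Finset.mem_filter.mp hh).1, fun hx h hh => ?_⟩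
      by_cases h0 : (fun i => (h.1 i : ℝ)) = (0 : Fin d → ℝ)
      · have := interior_subset hp h hh
        rw [h0, zero_dotProduct] at this ⊢
        exact this
      · exact hx h (Finset.mem_filter.mpr ⟨hh, h0⟩)
    have hint := interior_polyhedron H' (fun h i => (h.1 i : ℝ)) (fun h => (h.2 : ℝ))
      (fun h hh => (Finset.mem_filter.mp hh).2)
    rw [hHH'] at hp hb ⊢
    rw [hint] at hp ⊢
    obtain ⟨v, hv0, hv1, hgood, hv⟩ := exists_generic_shift H' hp
    obtain ⟨q, hq, h1, h2⟩ := exists_ehrhart_of_shift H' hb v hv0.le hv1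
      (fun h hh => ⟨(hv h hh).1.le, (hv h hh).2⟩)
    exact ⟨q, hq, h1, fun _ => h2 hgood fun h hh => (hv h hh).1⟩
  -- Without interior points only the counting statement is claimed, and the zero shift suffices.
  · obtain ⟨q, hq, h1, -⟩ := exists_ehrhart_of_shift H hb 0 le_rfl one_pos
      (fun h _ => by simp [slackAt])
    exact ⟨q, hq, h1, fun h => absurd h hne⟩

/-! ### Integral inequalities for rational cones and polytopes -/

theorem IsRationalVector.exists_integral_multiple {n : ℕ} {s : Fin n → ℝ} (hs : IsRationalVector s) :
    ∃ (D : ℝ) (s' : Fin n → ℤ), 0 < D ∧ ∀ i, s i = D * s' i := by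
  choose q hq using hs
  have hdvd : ∀ i, (q i).den ∣ ∏ j, (q j).den := fun i => Finset.dvd_prod_of_mem _ (Finset.mem_univ i)
  choose k hk using hdvd
  have hpos : 0 < ∏ j, (q j).den := Finset.prod_pos fun j _ => (q j).den_pos
  refine ⟨((∏ j, (q j).den : ℕ) : ℝ)⁻¹, fun i => (q i).num * k i, by positivity, fun i => ?_⟩
  have hden : ((q i).den : ℝ) ≠ 0 := by exact_mod_cast (q i).den_ne_zero
  have h1 : (((q i).den * k i : ℕ) : ℝ) ≠ 0 := by
    rw [← hk i]; exact_mod_cast hpos.ne'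
  have h2 : (q i : ℝ) = (q i).num / (q i).den := by exact_mod_cast (Rat.num_div_den (q i)).symm
  rw [hq i, hk i, eq_inv_mul_iff_mul_eq₀ h1, h2]
  push_cast
  field_simp

/-- Fourier-Motzkin elimination of one non-negative variable. -/
theorem exists_nonneg_iff {ι : Type*} (A : Finset ι) (f k : ι → ℝ) :
    (∃ μ : ℝ, 0 ≤ μ ∧ ∀ a ∈ A, f a ≤ μ * k a) ↔
      (∀ a ∈ A, k a ≤ 0 → f a ≤ 0) ∧ ∀ a ∈ A, 0 < k a → ∀ b ∈ A, k b < 0 →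
        k a * f b - k b * f a ≤ 0 := by
  classical
  constructor
  · rintro ⟨μ, hμ, h⟩
    refine ⟨fun a ha hk => (h a ha).trans (mul_nonpos_of_nonneg_of_nonpos hμ hk),
      fun a ha hka b hb hkb => ?_⟩
    have h1 := mul_le_mul_of_nonneg_left (h b hb) hka.le
    have h2 := mul_le_mul_of_nonneg_left (h a ha) (neg_pos.mpr hkb).le
    linarith
  · rintro ⟨h0, h1⟩
    -- All lower bounds on `μ`, including `0`; the largest one is feasible as soon as any is.
    let L := insert 0 ((A.filter fun a => 0 < k a).image fun a => f a / k a)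
    have hL : L.Nonempty := Finset.insert_nonempty _ _
    refine ⟨L.max' hL, L.le_max' _ (Finset.mem_insert_self _ _), fun a ha => ?_⟩
    rcases lt_trichotomy (k a) 0 with hk | hk | hk
    · rw [← neg_le_neg_iff, ← mul_neg, ← le_div_iff₀ (neg_pos.mpr hk), neg_div_neg_eq]
      refine L.max'_le hL _ fun l hl => ?_
      rcases Finset.mem_insert.mp hl with rfl | hl
      · exact div_nonneg_of_nonpos (h0 a ha hk.le) hk.le
      · obtain ⟨b, hb, rfl⟩ := Finset.mem_image.mp hl
        obtain ⟨hb, hkb⟩ := Finset.mem_filter.mp hb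
        have := h1 b hb hkb a ha hk
        rw [div_le_iff₀ hkb, div_mul_eq_mul_div, le_div_iff_of_neg hk]
        linarith
    · rw [hk, mul_zero]
      exact h0 a ha hk.le
    · rw [← div_le_iff₀ hk]
      exact L.le_max' _ (Finset.mem_insert_of_mem (Finset.mem_image_of_mem _
        (Finset.mem_filter.mpr ⟨ha, hk⟩)))

/-- A cone generated by finitely many rational vectors is cut out by integral inequalities. -/
theorem exists_integral_inequalities_hull {n : ℕ} (S : Finset (Fin n → ℝ))
    (hS : ∀ v ∈ S, IsRationalVector v) :
    ∃ A : Finset (Fin n → ℤ), (PointedCone.hull ℝ (S : Set (Fin n → ℝ)) : Set (Fin n → ℝ)) =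
      {x | ∀ a ∈ A, (fun i => (a i : ℝ)) ⬝ᵥ x ≤ 0} := by
  classical
  induction S using Finset.induction_on with
  | empty =>
    refine ⟨Finset.univ.image (fun i => Pi.single i 1) ∪ Finset.univ.image (fun i => Pi.single i (-1)),
      ?_⟩
    have hcast : ∀ (i : Fin n) (s : ℤ) (x : Fin n → ℝ),
        (fun j => ((Pi.single i s : Fin n → ℤ) j : ℝ)) ⬝ᵥ x = s * x i := by
      intro i s x
      rw [dotProduct, Finset.sum_eq_single i] <;> simp +contextual
    ext x
    simp only [Finset.coe_empty, PointedCone.hull, Submodule.span_empty, Submodule.bot_coe,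
      Set.mem_singleton_iff, Set.mem_ofPred_eq, Finset.mem_union, or_imp, forall_and,
      Finset.forall_mem_image, Finset.mem_univ, true_imp_iff, hcast]
    constructor
    · rintro rfl
      simp
    · rintro ⟨h1, h2⟩
      ext i
      have h1 := @h1 i
      have h2 := @h2 i
      push_cast at h1 h2
      simp only [Pi.zero_apply]
      linarith
  | insert s S _ ih =>
    obtain ⟨A, hA⟩ := ih fun v hv => hS v (Finset.mem_insert_of_mem hv)
    obtain ⟨D, s', hD, hs⟩ := (hS s (Finset.mem_insert_self _ _)).exists_integral_multiple
    have hs' : s = D • fun i => (s' i : ℝ) := funext hs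
    have hdot : ∀ a : Fin n → ℤ, (fun i => (a i : ℝ)) ⬝ᵥ (fun i => (s' i : ℝ)) =
        ((a ⬝ᵥ s' : ℤ) : ℝ) := fun a => by simp [dotProduct]
    -- A point lies in the larger cone iff subtracting some `μ s'` with `μ ≥ 0` brings it into the
    -- smaller one. Eliminating `μ` leaves these integral inequalities.
    refine ⟨(A.filter fun a => a ⬝ᵥ s' ≤ 0) ∪
      ((A.filter fun a => 0 < a ⬝ᵥ s') ×ˢ (A.filter fun a => a ⬝ᵥ s' < 0)).image
        (fun p => (p.1 ⬝ᵥ s') • p.2 - (p.2 ⬝ᵥ s') • p.1), ?_⟩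
    ext x
    have h1 : x ∈ (PointedCone.hull ℝ ((insert s S : Finset _) : Set (Fin n → ℝ)) : Set (Fin n → ℝ)) ↔
        ∃ μ : ℝ, 0 ≤ μ ∧ ∀ a ∈ A, (fun i => (a i : ℝ)) ⬝ᵥ x ≤ μ * ((a ⬝ᵥ s' : ℤ) : ℝ) := by
      rw [Finset.coe_insert, PointedCone.hull, SetLike.mem_coe, Submodule.mem_span_insert]
      have hmem : ∀ z, z ∈ Submodule.span {c : ℝ // 0 ≤ c} (S : Set (Fin n → ℝ)) ↔
          ∀ a ∈ A, (fun i => (a i : ℝ)) ⬝ᵥ z ≤ 0 := fun z => Set.ext_iff.mp hA z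
      constructor
      · rintro ⟨c, z, hz, rfl⟩
        refine ⟨c * D, mul_nonneg c.2 hD.le, fun a ha => ?_⟩
        have := (hmem z).mp hz a ha
        have hc : c • s = (c * D : ℝ) • fun i => (s' i : ℝ) := by
          rw [hs', mul_smul]; rfl
        rw [dotProduct_add, hc, dotProduct_smul, hdot, smul_eq_mul]
        linarith
      · rintro ⟨μ, hμ, h⟩
        refine ⟨⟨μ / D, by positivity⟩, x - μ • fun i => (s' i : ℝ), (hmem _).mpr fun a ha => ?_, ?_⟩
        · rw [dotProduct_sub, dotProduct_smul, hdot, smul_eq_mul]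
          linarith [h a ha]
        · have hc : (⟨μ / D, by positivity⟩ : {c : ℝ // 0 ≤ c}) • s = μ • fun i => (s' i : ℝ) := by
            rw [hs']
            change (μ / D) • (D • fun i => (s' i : ℝ)) = _
            rw [smul_smul, div_mul_cancel₀ _ hD.ne']
          rw [hc, add_sub_cancel]
    rw [h1, exists_nonneg_iff]
    simp only [Set.mem_ofPred_eq, Finset.mem_union, or_imp, forall_and, Finset.mem_filter,
      Finset.forall_mem_image, Finset.mem_product, Prod.forall, and_imp]
    refine and_congr ?_ ?_
    · refine forall₂_congr fun a _ => ?_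
      rw [Int.cast_nonpos]
    · have hcomb : ∀ a b : Fin n → ℤ, (fun i => (((a ⬝ᵥ s') • b - (b ⬝ᵥ s') • a) i : ℝ)) ⬝ᵥ x =
          ((a ⬝ᵥ s' : ℤ) : ℝ) * (fun i => (b i : ℝ)) ⬝ᵥ x -
          ((b ⬝ᵥ s' : ℤ) : ℝ) * (fun i => (a i : ℝ)) ⬝ᵥ x := by
        intro a b
        generalize a ⬝ᵥ s' = p
        generalize b ⬝ᵥ s' = q
        simp only [dotProduct, Finset.mul_sum, ← Finset.sum_sub_distrib]
        refine Finset.sum_congr rfl fun i _ => ?_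
        simp
        ring
      simp only [hcomb, Int.cast_pos, Int.cast_lt_zero]
      constructor
      · exact fun h a b ha hka hb hkb => h a ha hka b hb hkb
      · exact fun h a ha hka b hb hkb => h a b ha hka hb hkb

theorem isIntegralPolyhedron_hull {d : ℕ} (S : Finset (Fin d → ℝ)) (hS : ∀ v ∈ S, IsRationalVector v) :
    IsIntegralPolyhedron (PointedCone.hull ℝ (S : Set (Fin d → ℝ)) : Set (Fin d → ℝ)) := by
  classical
  obtain ⟨A, hA⟩ := exists_integral_inequalities_hull S hS
  refine ⟨A.image fun a => (a, 0), ?_⟩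
  rw [hA]
  ext x
  simp

/-- Homogenization: all generators have last coordinate `1`, so the coefficients of a conic
combination at height one sum to `1`. -/
theorem mem_convexHull_iff_snoc_mem_hull {d : ℕ} [DecidableEq (Fin (d + 1) → ℝ)]
    (S : Finset (Fin d → ℝ)) (x : Fin d → ℝ) :
    x ∈ convexHull ℝ (S : Set (Fin d → ℝ)) ↔ (Fin.snoc x 1 : Fin (d + 1) → ℝ) ∈
      PointedCone.hull ℝ ((S.image fun s => (Fin.snoc s 1 : Fin (d + 1) → ℝ) : Finset _) :
        Set (Fin (d + 1) → ℝ)) := by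
  have hinj : Set.InjOn (fun s : Fin d → ℝ => (Fin.snoc s 1 : Fin (d + 1) → ℝ)) S := by
    intro s _ s' _ h
    ext i
    simpa using congrFun h i.castSucc
  have hsum : ∀ w : (Fin d → ℝ) → ℝ, ∑ s ∈ S, w s • (Fin.snoc s 1 : Fin (d + 1) → ℝ) =
      Fin.snoc (∑ s ∈ S, w s • s) (∑ s ∈ S, w s) := by
    intro w
    refine funext fun i => Fin.lastCases ?_ (fun j => ?_) i <;> simp [Finset.sum_apply]
  rw [Finset.mem_convexHull']
  constructor
  · rintro ⟨w, hw, hw1, hx⟩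
    have h := hsum w
    rw [hx, hw1] at h
    rw [← h]
    refine Submodule.sum_mem _ fun s hs => ?_
    exact Submodule.smul_mem _ (⟨w s, hw s hs⟩ : {c : ℝ // 0 ≤ c})
      (Submodule.subset_span (Finset.mem_coe.mpr (Finset.mem_image_of_mem _ hs)))
  · rw [PointedCone.hull, Submodule.mem_span_finset]
    rintro ⟨f, -, hf⟩
    let g : (Fin d → ℝ) → ℝ := fun s => (f (Fin.snoc s 1)).1
    have hg : ∑ s ∈ S, g s • (Fin.snoc s 1 : Fin (d + 1) → ℝ) = Fin.snoc x 1 := by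
      rw [← hf, Finset.sum_image hinj]
      rfl
    rw [hsum] at hg
    refine ⟨g, fun s _ => (f _).2, ?_, ?_⟩
    · simpa using congrFun hg (Fin.last d)
    · ext i
      simpa using congrFun hg i.castSucc

theorem IsRationalPolytope.isIntegralPolyhedron {d : ℕ} {Q : Set (Fin d → ℝ)}
    (hQ : IsRationalPolytope Q) : IsIntegralPolyhedron Q := by
  classical
  obtain ⟨S, hS, rfl⟩ := hQ
  obtain ⟨A, hA⟩ := exists_integral_inequalities_hull
    (S.image fun s => (Fin.snoc s 1 : Fin (d + 1) → ℝ)) (by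
      intro v hv
      obtain ⟨s, hs, rfl⟩ := Finset.mem_image.mp hv
      refine fun i => Fin.lastCases ⟨1, by simp⟩ (fun j => ?_) i
      simpa using hS s hs j)
  refine ⟨A.image fun a => (Fin.init a, -a (Fin.last d)), ?_⟩
  ext x
  rw [mem_convexHull_iff_snoc_mem_hull, ← SetLike.mem_coe, hA]
  simp only [Set.mem_ofPred_eq, Finset.forall_mem_image]
  refine forall₂_congr fun a _ => ?_
  simp only [dotProduct, Fin.sum_univ_castSucc, Fin.snoc_castSucc, Fin.snoc_last, mul_one, Fin.init]
  push_cast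
  constructor <;> intro h <;> linarith

/-! ### Growth and degree of quasipolynomials -/

open Filter Topology

namespace IsQuasiPoly

variable {f g : ℤ → ℝ}

theorem of_mul {M k : ℕ} (h : ∀ r : ℤ, ∃ p : Polynomial ℝ, ∀ t : ℤ, f (M * t + r) = p.eval (t : ℝ))
    (r : ℤ) : ∃ p : Polynomial ℝ, ∀ t : ℤ, f ((M * k : ℕ) * t + r) = p.eval (t : ℝ) := by
  obtain ⟨p, hp⟩ := h r
  refine ⟨p.comp (Polynomial.C (k : ℝ) * Polynomial.X), fun t => ?_⟩
  have := hp (k * t)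
  simpa [mul_assoc] using this

theorem zero : IsQuasiPoly (fun _ => 0) := ⟨1, one_pos, fun _ => ⟨0, fun _ => by simp⟩⟩

theorem add (hf : IsQuasiPoly f) (hg : IsQuasiPoly g) : IsQuasiPoly (fun t => f t + g t) := by
  obtain ⟨M, hM, h⟩ := hf
  obtain ⟨K, hK, k⟩ := hg
  refine ⟨M * K, by positivity, fun r => ?_⟩
  obtain ⟨p, hp⟩ := of_mul (k := K) h r
  obtain ⟨q, hq⟩ := of_mul (k := M) k r
  rw [mul_comm K M] at hq
  exact ⟨p + q, fun t => by simp only [hp, hq, Polynomial.eval_add]⟩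

theorem sum {ι : Type*} (s : Finset ι) {F : ι → ℤ → ℝ} (h : ∀ i ∈ s, IsQuasiPoly (F i)) :
    IsQuasiPoly (fun t => ∑ i ∈ s, F i t) := by
  classical
  induction s using Finset.induction_on with
  | empty => simpa using zero
  | insert a s ha ih =>
    simp only [Finset.sum_insert ha]
    exact (h a (by simp)).add (ih fun i hi => h i (by simp [hi]))

/-- Substituting `(t - r) / M` for the quotient makes each residue polynomial a polynomial in `t`
itself, whose coefficients then depend periodically on `t`. -/
theorem exists_eval (hf : IsQuasiPoly f) : ∃ (M : ℕ) (R : ℤ → Polynomial ℝ), 0 < M ∧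
    ∀ t : ℤ, f t = (R (t % M)).eval (t : ℝ) := by
  obtain ⟨M, hM, h⟩ := hf
  choose p hp using h
  refine ⟨M, fun r => (p r).comp (Polynomial.C (M : ℝ)⁻¹ * (Polynomial.X - Polynomial.C (r : ℝ))), hM,
    fun t => ?_⟩
  have hM' : (M : ℝ) ≠ 0 := by positivity
  have h1 := hp (t % M) (t / M)
  rw [Int.mul_ediv_add_emod] at h1
  rw [h1, Polynomial.eval_comp]
  congr 1
  have h2 : (t : ℝ) = M * ((t / M : ℤ) : ℝ) + ((t % M : ℤ) : ℝ) := by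
    exact_mod_cast (Int.mul_ediv_add_emod t M).symm
  simp only [Polynomial.eval_mul, Polynomial.eval_C, Polynomial.eval_sub, Polynomial.eval_X]
  rw [eq_inv_mul_iff_mul_eq₀ hM', h2]
  ring_nf

end IsQuasiPoly

/-- If the degree exceeded `d`, then `X ^ d / P` would tend to `0` along `u`, against the bound. -/
theorem degree_le_of_bound {P : Polynomial ℝ} {d : ℕ} {C : ℝ} {u : ℕ → ℝ} (hu : Tendsto u atTop atTop)
    (h : ∀ k, |P.eval (u k)| ≤ C * u k ^ d) : P.natDegree ≤ d := by
  by_contra! hlt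
  have hP : P ≠ 0 := fun h0 => by simp [h0] at hlt
  have hdeg : (Polynomial.X ^ d : Polynomial ℝ).degree < P.degree := by
    rw [Polynomial.degree_X_pow, Polynomial.degree_eq_natDegree hP]
    exact_mod_cast hlt
  have hlim := (Polynomial.div_tendsto_atTop_zero_of_degree_lt _ _ hdeg).comp hu
  have hC : (0 : ℝ) < (|C| + 1)⁻¹ := by positivity
  have h1 := (Metric.tendsto_nhds.mp hlim) _ hC
  have h2 := hu.eventually (Polynomial.eventually_atTop_not_isRoot P hP)
  obtain ⟨k, hk, hk2, hk3⟩ := (h1.and (h2.and (hu.eventually_gt_atTop 0))).exists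
  have hne : 0 < |P.eval (u k)| := abs_pos.mpr hk2
  have hpow : 0 < u k ^ d := by positivity
  simp only [Function.comp, Polynomial.eval_pow, Polynomial.eval_X, dist_zero_right,
    Real.norm_eq_abs, abs_div, abs_of_pos hpow] at hk
  rw [div_lt_iff₀ hne, inv_mul_eq_div, lt_div_iff₀ (by positivity)] at hk
  have := h k
  have h3 : C * u k ^ d ≤ |C| * u k ^ d := mul_le_mul_of_nonneg_right (le_abs_self C) hpow.le
  linarith

/-- The upper bound limits the degree on every residue class; the lower bound, along the multiples
of `M`, prevents the coefficient of `t ^ d` from vanishing on class `0`. -/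
theorem IsQuasiPoly.isQuasipolynomial {f : ℤ → ℝ} (hf : IsQuasiPoly f) {d : ℕ} {C κ : ℝ} {T : ℕ}
    (hκ : 0 < κ) (h0 : ∀ t : ℕ, 0 < t → 0 ≤ f t) (hC : ∀ t : ℕ, 0 < t → f t ≤ C * (t : ℝ) ^ d)
    (hlow : ∀ t : ℕ, T ≤ t → κ * (t : ℝ) ^ d ≤ f t) : IsQuasipolynomial f d := by
  obtain ⟨M, R, hM, hR⟩ := hf.exists_eval
  have hM' : (0 : ℤ) < M := by exact_mod_cast hM
  have hu : ∀ r : ℕ, Tendsto (fun k : ℕ => ((M * (k + 1) + r : ℕ) : ℝ)) atTop atTop := by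
    intro r
    refine tendsto_natCast_atTop_atTop.comp (tendsto_atTop_mono (fun k => ?_) tendsto_id)
    have : k + 1 ≤ M * (k + 1) := Nat.le_mul_of_pos_left _ hM
    simp only [id]
    omega
  have hdeg : ∀ t : ℤ, (R (t % M)).natDegree ≤ d := by
    intro t
    obtain ⟨r, hr⟩ : ∃ r : ℕ, t % M = r := ⟨(t % M).toNat, by
      rw [Int.toNat_of_nonneg (Int.emod_nonneg _ hM'.ne')]⟩
    have hrM : (r : ℤ) < M := hr ▸ Int.emod_lt_of_pos _ hM'
    refine degree_le_of_bound (C := C) (hu r) fun k => ?_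
    have h1 := hR ((M * (k + 1) + r : ℕ) : ℤ)
    have h2 : ((M * (k + 1) + r : ℕ) : ℤ) % M = t % M := by
      push_cast
      rw [Int.mul_add_emod_self_left, hr, Int.emod_eq_of_lt (by omega) hrM]
    have hpos : 0 < M * (k + 1) + r := by positivity
    rw [h2, Int.cast_natCast] at h1
    rw [← h1, abs_of_nonneg (h0 _ hpos)]
    exact hC _ hpos
  refine ⟨fun i t => (R (t % M)).coeff i, fun i => ⟨M, hM, fun t => by simp⟩, fun hzero => ?_,
    fun t => ?_⟩
  · have hc : (R 0).coeff d = 0 := by simpa using congrFun hzero 0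
    have hd0 : (R 0).natDegree ≤ d := by simpa using hdeg 0
    have hlt : (R 0).degree < (Polynomial.X ^ d : Polynomial ℝ).degree := by
      rw [Polynomial.degree_X_pow, Polynomial.degree_lt_iff_coeff_zero]
      intro m hm
      rcases hm.eq_or_lt with rfl | hm
      · exact hc
      · exact Polynomial.coeff_eq_zero_of_natDegree_lt (hd0.trans_lt hm)
    have hlim := (Polynomial.div_tendsto_atTop_zero_of_degree_lt _ _ hlt).comp (hu 0)
    obtain ⟨k, hk, hkT⟩ := (((Metric.tendsto_nhds.mp hlim) _ hκ).and (eventually_ge_atTop T)).exists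
    have hpos : 0 < M * (k + 1) := by positivity
    have hposR : (0 : ℝ) < ((M * (k + 1) : ℕ) : ℝ) := by exact_mod_cast hpos
    have hTk : T ≤ M * (k + 1) := by nlinarith
    have h1 := hR ((M * (k + 1) : ℕ) : ℤ)
    have h2 : ((M * (k + 1) : ℕ) : ℤ) % M = 0 := by push_cast; simp
    rw [h2, Int.cast_natCast] at h1
    have h3 := hlow _ hTk
    simp only [Function.comp, Polynomial.eval_pow, Polynomial.eval_X, dist_zero_right,
      Real.norm_eq_abs, add_zero, ← h1] at hk
    have h4 := (le_abs_self _).trans_lt hk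
    rw [div_lt_iff₀ (by positivity)] at h4
    linarith
  · rw [hR t, Polynomial.eval_eq_sum_range' (Nat.lt_succ_of_le (hdeg t))]

theorem IsQuasipolynomial.reflect {f : ℤ → ℝ} {d : ℕ} (hf : IsQuasipolynomial f d) :
    IsQuasipolynomial (fun t => (-1 : ℝ) ^ d * f (-t)) d := by
  obtain ⟨c, hc, hcd, hf⟩ := hf
  refine ⟨fun i t => (-1 : ℝ) ^ d * (-1) ^ i * c i (-t), fun i => ?_, fun h => hcd ?_, fun t => ?_⟩
  · obtain ⟨k, hk, hp⟩ := hc i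
    refine ⟨k, hk, fun t => ?_⟩
    have := hp.neg (-t)
    simp only [neg_add]
    rw [← this]
  · ext t
    have := congrFun h (-t)
    simpa using this
  · simp only [hf, Finset.mul_sum]
    refine Finset.sum_congr rfl fun i _ => ?_
    push_cast
    rw [neg_pow (t : ℝ)]
    ring

theorem exists_ehr_le {d : ℕ} {A : Set (Fin d → ℝ)} (hA : Bornology.IsBounded A) :
    ∃ C : ℝ, 0 ≤ C ∧ ∀ t : ℕ, 0 < t → (ehr A t : ℝ) ≤ C * (t : ℝ) ^ d := by
  obtain ⟨R, hR⟩ := hA.exists_norm_le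
  refine ⟨(2 * |R| + 3) ^ d, by positivity, fun t ht => ?_⟩
  have ht' : (1 : ℝ) ≤ t := by exact_mod_cast ht
  have hsub : {z : Fin d → ℤ | latticePoint t z ∈ A} ⊆
      (Finset.Icc (fun _ => ⌈-(|R| * t)⌉) (fun _ => ⌊|R| * t⌋) : Finset (Fin d → ℤ)) := by
    intro z hz
    have key : ∀ i, |(z i : ℝ)| ≤ |R| * t := by
      intro i
      have h := (norm_le_pi_norm (latticePoint t z) i).trans ((hR _ hz).trans (le_abs_self R))
      rw [latticePoint, Real.norm_eq_abs, abs_div, abs_of_pos (by linarith : (0 : ℝ) < t),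
        div_le_iff₀ (by linarith)] at h
      exact h
    rw [Finset.coe_Icc]
    exact ⟨fun i => Int.ceil_le.mpr (abs_le.mp (key i)).1, fun i => Int.le_floor.mpr (abs_le.mp (key i)).2⟩
  have h1 := Set.ncard_le_ncard hsub (Finset.finite_toSet _)
  rw [Set.ncard_coe_finset, Pi.card_Icc] at h1
  simp only [Int.card_Icc, Finset.prod_const, Finset.card_univ, Fintype.card_fin] at h1
  have h2 : (((⌊|R| * t⌋ + 1 - ⌈-(|R| * t)⌉).toNat : ℕ) : ℝ) ≤ (2 * |R| + 3) * t := by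
    have hf := Int.floor_nonneg.mpr (by positivity : 0 ≤ |R| * t)
    rw [Int.ceil_neg]
    have : (((⌊|R| * t⌋ + 1 - -⌊|R| * t⌋).toNat : ℕ) : ℝ) = ((⌊|R| * t⌋ + 1 - -⌊|R| * t⌋ : ℤ) : ℝ) := by
      exact_mod_cast Int.toNat_of_nonneg (by omega)
    rw [this]
    push_cast
    have := Int.floor_le (|R| * t)
    linarith
  rw [← mul_pow]
  have h3 : (ehr A t : ℝ) ≤ (((⌊|R| * t⌋ + 1 - ⌈-(|R| * t)⌉).toNat : ℕ) : ℝ) ^ d := by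
    exact_mod_cast h1
  exact h3.trans (pow_le_pow_left₀ (by positivity) h2 d)

theorem exists_le_ehr {d : ℕ} {A : Set (Fin d → ℝ)} (hA : Bornology.IsBounded A)
    (hne : (interior A).Nonempty) :
    ∃ κ : ℝ, 0 < κ ∧ ∃ T : ℕ, ∀ t : ℕ, T ≤ t → κ * (t : ℝ) ^ d ≤ ehr A t := by
  obtain ⟨x, hx⟩ := hne
  obtain ⟨δ, hδ, hball⟩ := Metric.nhds_basis_closedBall.mem_iff.mp (mem_interior_iff_mem_nhds.mp hx)
  -- Each side of the cube of radius `δ` holds more than `2 δ t - 1` points, which is at least `δ t`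
  -- once `δ t ≥ 1`.
  refine ⟨δ ^ d, by positivity, ⌈1 / δ⌉₊ + 1, fun t ht => ?_⟩
  have ht0 : 0 < t := by omega
  have ht' : (0 : ℝ) < t := by exact_mod_cast ht0
  have htδ : 1 ≤ δ * t := by
    rw [← div_le_iff₀' hδ]
    exact (Nat.le_ceil _).trans (by exact_mod_cast (by omega : ⌈1 / δ⌉₊ ≤ t))
  have hsub : ((Finset.Icc (fun i => ⌈t * (x i - δ)⌉) (fun i => ⌊t * (x i + δ)⌋) :
      Finset (Fin d → ℤ)) : Set (Fin d → ℤ)) ⊆ {z : Fin d → ℤ | latticePoint t z ∈ A} := by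
    intro z hz
    rw [Finset.coe_Icc] at hz
    refine hball ?_
    rw [Metric.mem_closedBall, dist_pi_le_iff hδ.le]
    intro i
    have h1 := Int.ceil_le.mp (hz.1 i)
    have h2 := Int.le_floor.mp (hz.2 i)
    rw [Real.dist_eq, latticePoint, abs_le]
    constructor
    · rw [neg_le_sub_iff_le_add, ← sub_le_iff_le_add, le_div_iff₀ ht']
      linarith
    · rw [sub_le_iff_le_add, div_le_iff₀ ht']
      linarith
  have h1 := Set.ncard_le_ncard hsub (finite_latticePoint_mem hA ht0)
  rw [Set.ncard_coe_finset, Pi.card_Icc] at h1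
  have h2 : (∏ i : Fin d, ((Finset.Icc ⌈t * (x i - δ)⌉ ⌊t * (x i + δ)⌋).card : ℝ)) ≤ ehr A t := by
    exact_mod_cast h1
  refine le_trans ?_ h2
  rw [← mul_pow]
  have h3 : (δ * t) ^ d = ∏ _i : Fin d, (δ * t) := by simp
  rw [h3]
  refine Finset.prod_le_prod (fun _ _ => by positivity) fun i _ => ?_
  rw [Int.card_Icc]
  have h4 : ((⌊t * (x i + δ)⌋ + 1 - ⌈t * (x i - δ)⌉ : ℤ) : ℝ) ≤
      (((⌊t * (x i + δ)⌋ + 1 - ⌈t * (x i - δ)⌉).toNat : ℕ) : ℝ) := by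
    exact_mod_cast Int.self_le_toNat _
  refine le_trans ?_ h4
  have h5 := Int.lt_floor_add_one (t * (x i + δ))
  have h6 := Int.ceil_lt_add_one (t * (x i - δ))
  push_cast
  linarith

/-! ### Full-dimensional cones and regions of a complete fan -/

variable {d : ℕ}

theorem interior_nonempty_of_dim_eq {A : Set (Fin d → ℝ)} (hA : Convex ℝ A) (hne : A.Nonempty)
    (hdim : dim A = d) : (interior A).Nonempty := by
  rw [hA.interior_nonempty_iff_affineSpan_eq_top]
  rw [← AffineSubspace.direction_eq_top_iff_of_nonempty
    ((affineSpan_nonempty ℝ).mpr hne)]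
  refine Submodule.eq_top_of_finrank_eq ?_
  rw [Module.finrank_fin_fun]
  exact hdim

theorem dim_eq_of_interior_nonempty {A : Set (Fin d → ℝ)} (h : (interior A).Nonempty) :
    dim A = d := by
  have h1 : affineSpan ℝ (interior A) = ⊤ := isOpen_interior.affineSpan_eq_top h
  have h2 : affineSpan ℝ A = ⊤ := top_le_iff.mp (h1 ▸ affineSpan_mono ℝ interior_subset)
  rw [dim, h2, AffineSubspace.direction_top, finrank_top, Module.finrank_fin_fun]

theorem dim_le (A : Set (Fin d → ℝ)) : dim A ≤ d := by
  have := Submodule.finrank_le (affineSpan ℝ A).direction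
  rwa [Module.finrank_fin_fun] at this

theorem dim_mono {A B : Set (Fin d → ℝ)} (h : A ⊆ B) : dim A ≤ dim B :=
  Submodule.finrank_mono (AffineSubspace.direction_le (affineSpan_mono ℝ h))

theorem IsPolyhedron.convex {P : Set (Fin d → ℝ)} (hP : IsPolyhedron P) : Convex ℝ P := by
  obtain ⟨H, rfl⟩ := hP
  intro x hx y hy a b ha hb hab h hh
  rw [dotProduct_add, dotProduct_smul, dotProduct_smul, smul_eq_mul, smul_eq_mul]
  have h1 := mul_le_mul_of_nonneg_left (hx h hh) ha
  have h2 := mul_le_mul_of_nonneg_left (hy h hh) hb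
  have h3 : a * h.2 + b * h.2 = h.2 := by rw [← add_mul, hab, one_mul]
  linarith

theorem IsPolyhedron.isClosed {P : Set (Fin d → ℝ)} (hP : IsPolyhedron P) : IsClosed P := by
  obtain ⟨H, rfl⟩ := hP
  have : {x : Fin d → ℝ | ∀ h ∈ H, h.1 ⬝ᵥ x ≤ h.2} = ⋂ h ∈ H, {x | h.1 ⬝ᵥ x ≤ h.2} := by
    ext x; simp
  rw [this]
  refine isClosed_biInter fun h _ => ?_
  have hc : Continuous fun x : Fin d → ℝ => h.1 ⬝ᵥ x := by
    simp only [dotProduct]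
    fun_prop
  exact isClosed_le hc continuous_const

theorem IsFace.eq_of_mem_interior {F P : Set (Fin d → ℝ)} (hF : IsFace F P) {x : Fin d → ℝ}
    (hx : x ∈ interior P) (hxF : x ∈ F) : F = P := by
  obtain ⟨a, b, hab, rfl⟩ := hF
  have ha := eq_zero_of_mem_interior hab hx hxF.2
  have hb : b = 0 := by rw [← hxF.2, ha, zero_dotProduct]
  ext y
  simp [ha, hb]

/-- A point of a full-dimensional polyhedron outside the interior lies on a face of smaller
dimension. -/
theorem IsPolyhedron.exists_face {P : Set (Fin d → ℝ)} (hP : IsPolyhedron P) {x : Fin d → ℝ}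
    (hx : x ∈ P) (hxi : x ∉ interior P) : ∃ F, IsFace F P ∧ x ∈ F ∧ dim F < d := by
  classical
  have hconv := hP.convex
  obtain ⟨H, rfl⟩ := hP
  have hex : ∃ h ∈ H, h.1 ≠ 0 ∧ h.1 ⬝ᵥ x = h.2 := by
    by_contra! hcon
    refine hxi ?_
    have hsub : {x : Fin d → ℝ | ∀ h ∈ H.filter (fun h => h.1 ≠ 0), h.1 ⬝ᵥ x ≤ h.2} ⊆
        {x | ∀ h ∈ H, h.1 ⬝ᵥ x ≤ h.2} := by
      intro y hy h hh
      by_cases h0 : h.1 = 0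
      · have := hx h hh
        rw [h0, zero_dotProduct] at this ⊢
        exact this
      · exact hy h (Finset.mem_filter.mpr ⟨hh, h0⟩)
    refine interior_mono hsub ?_
    rw [interior_polyhedron _ (fun h : (Fin d → ℝ) × ℝ => h.1) (fun h => h.2) (fun h hh => (Finset.mem_filter.mp hh).2)]
    intro h hh
    obtain ⟨hh, h0⟩ := Finset.mem_filter.mp hh
    exact lt_of_le_of_ne (hx h hh) (hcon h hh h0)
  obtain ⟨h, hh, h0, hxh⟩ := hex
  refine ⟨_, ⟨h.1, h.2, fun y hy => hy h hh, rfl⟩, ⟨hx, hxh⟩, lt_of_le_of_ne (dim_le _) fun hdim => h0 ?_⟩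
  have hFconv : Convex ℝ {y ∈ {x : Fin d → ℝ | ∀ h ∈ H, h.1 ⬝ᵥ x ≤ h.2} | h.1 ⬝ᵥ y = h.2} := by
    refine hconv.inter (?_ : Convex ℝ {y : Fin d → ℝ | h.1 ⬝ᵥ y = h.2})
    intro y hy z hz a b _ _ hab
    change h.1 ⬝ᵥ _ = _
    rw [dotProduct_add, dotProduct_smul, dotProduct_smul, show h.1 ⬝ᵥ y = h.2 from hy,
      show h.1 ⬝ᵥ z = h.2 from hz, ← add_smul, hab, one_smul]
  obtain ⟨y, hy⟩ := interior_nonempty_of_dim_eq hFconv ⟨x, hx, hxh⟩ hdim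
  exact eq_zero_of_mem_interior (fun z hz => hz.2.le) hy (interior_subset hy).2

namespace IsCompleteFan

variable {𝒩 : Set (Set (Fin d → ℝ))} (h𝒩 : IsCompleteFan 𝒩)

include h𝒩

theorem convex {N : Set (Fin d → ℝ)} (hN : N ∈ 𝒩) : Convex ℝ N := (h𝒩.cone N hN).1.convex

theorem isClosed {N : Set (Fin d → ℝ)} (hN : N ∈ 𝒩) : IsClosed N := (h𝒩.cone N hN).1.isClosed

theorem subset_of_mem_interior {N N' : Set (Fin d → ℝ)} (hN : N ∈ 𝒩) (hN' : N' ∈ 𝒩)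
    {x : Fin d → ℝ} (hx : x ∈ interior N) (hx' : x ∈ N') : N ⊆ N' := by
  have h := (h𝒩.inter_face N hN N' hN').1.eq_of_mem_interior hx ⟨interior_subset hx, hx'⟩
  exact Set.inter_eq_left.mp h

theorem eq_of_mem_interior {N N' : Set (Fin d → ℝ)} (hN : N ∈ 𝒩) (hN' : N' ∈ 𝒩)
    {x : Fin d → ℝ} (hx : x ∈ interior N) (hx' : x ∈ interior N') : N = N' :=
  (h𝒩.subset_of_mem_interior hN hN' hx (interior_subset hx')).antisymm
    (h𝒩.subset_of_mem_interior hN' hN hx' (interior_subset hx))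

/-- A boundary point of a full-dimensional cone lies on a lower-dimensional face, itself in the fan.
Conversely, a cone containing an interior point of `N` contains all of `N`, hence is
full-dimensional. -/
theorem notMem_codimOne_iff (x : Fin d → ℝ) :
    x ∉ ⋃₀ codimOne 𝒩 ↔ ∃ N ∈ 𝒩, dim N = d ∧ x ∈ interior N := by
  constructor
  · intro hx
    obtain ⟨N, hN, hxN⟩ : x ∈ ⋃₀ 𝒩 := by rw [h𝒩.cover]; trivial
    have hdim : dim N = d := le_antisymm (dim_le N) (not_lt.mp fun h => hx ⟨N, ⟨hN, h⟩, hxN⟩)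
    refine ⟨N, hN, hdim, ?_⟩
    by_contra hxi
    obtain ⟨F, hF, hxF, hFd⟩ := (h𝒩.cone N hN).1.exists_face hxN hxi
    exact hx ⟨F, ⟨h𝒩.face_mem N hN F hF ⟨x, hxF⟩, hFd⟩, hxF⟩
  · rintro ⟨N, hN, hdim, hx⟩ ⟨N', ⟨hN', hd⟩, hx'⟩
    have := dim_mono (h𝒩.subset_of_mem_interior hN hN' hx hx')
    omega

theorem mem_pruned_iff (A : Set (Fin d → ℝ)) (x : Fin d → ℝ) :
    x ∈ pruned A 𝒩 ↔ x ∈ A ∧ ∃ N ∈ 𝒩, dim N = d ∧ x ∈ interior N := by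
  rw [← h𝒩.notMem_codimOne_iff]
  rfl

/-- Finitely many closed cones without interior cannot fill a non-empty open set. -/
theorem exists_interior_inter_nonempty {U : Set (Fin d → ℝ)} (hU : IsOpen U) (hne : U.Nonempty) :
    ∃ N ∈ 𝒩, dim N = d ∧ (interior N ∩ U).Nonempty := by
  have hdense : Dense (⋂ N ∈ codimOne 𝒩, Nᶜ) := by
    refine dense_biInter_of_isOpen (fun N hN => (h𝒩.isClosed hN.1).isOpen_compl)
      (h𝒩.finite.subset fun N hN => hN.1).countable fun N hN => ?_
    rw [← interior_eq_empty_iff_dense_compl, ← Set.not_nonempty_iff_eq_empty]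
    exact fun h => hN.2.ne (dim_eq_of_interior_nonempty h)
  obtain ⟨x, hxU, hx⟩ := hdense.inter_open_nonempty U hU hne
  have hx' : x ∉ ⋃₀ codimOne 𝒩 := by
    rintro ⟨N, hN, hxN⟩
    exact Set.mem_iInter₂.mp hx N hN hxN
  obtain ⟨N, hN, hd, hxN⟩ := (h𝒩.notMem_codimOne_iff x).mp hx'
  exact ⟨N, hN, hd, x, hxN, hxU⟩

/-- The interiors of the cones are pairwise disjoint open sets covering the pruned set, so a
component stays in one of them; and `Q ∩ interior N` is convex, hence connected. -/
theorem connectedComponentIn_pruned {Q N : Set (Fin d → ℝ)} (hQ : Convex ℝ Q) (hN : N ∈ 𝒩)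
    (hd : dim N = d) {x : Fin d → ℝ} (hxQ : x ∈ Q) (hxN : x ∈ interior N) :
    connectedComponentIn (pruned Q 𝒩) x = Q ∩ interior N := by
  have hx : x ∈ pruned Q 𝒩 := (h𝒩.mem_pruned_iff Q x).mpr ⟨hxQ, N, hN, hd, hxN⟩
  refine Set.Subset.antisymm ?_ ?_
  · refine Set.subset_inter (fun y hy => (connectedComponentIn_subset _ _ hy).1) ?_
    refine isPreconnected_connectedComponentIn.subset_left_of_subset_union isOpen_interior
      (v := ⋃ N' ∈ {N' ∈ 𝒩 | N' ≠ N}, interior N') (isOpen_biUnion fun _ _ => isOpen_interior)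
      ?_ ?_ ⟨x, mem_connectedComponentIn hx, hxN⟩
    · rw [Set.disjoint_left]
      intro y hy hy'
      obtain ⟨N', hN', hyN'⟩ := Set.mem_iUnion₂.mp hy'
      exact hN'.2 (h𝒩.eq_of_mem_interior hN'.1 hN hyN' hy)
    · intro y hy
      obtain ⟨-, N', hN', -, hyN'⟩ := (h𝒩.mem_pruned_iff Q y).mp (connectedComponentIn_subset _ _ hy)
      by_cases h : N' = N
      · exact Or.inl (h ▸ hyN')
      · exact Or.inr (Set.mem_iUnion₂.mpr ⟨N', ⟨hN', h⟩, hyN'⟩)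
  · refine (hQ.inter (h𝒩.convex hN).interior).isPreconnected.subset_connectedComponentIn
      ⟨hxQ, hxN⟩ fun y hy => ?_
    exact (h𝒩.mem_pruned_iff Q y).mpr ⟨hy.1, N, hN, hd, hy.2⟩

theorem regions_eq {Q : Set (Fin d → ℝ)} (hQ : Convex ℝ Q) (hQi : (interior Q).Nonempty) :
    regions Q 𝒩 = (fun N => Q ∩ interior N) ''
      {N ∈ 𝒩 | dim N = d ∧ (interior N ∩ interior Q).Nonempty} := by
  ext R
  constructor
  · rintro ⟨x, hx, rfl⟩
    obtain ⟨hxQ, N, hN, hd, hxN⟩ := (h𝒩.mem_pruned_iff Q x).mp hx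
    refine ⟨N, ⟨hN, hd, ?_⟩, (h𝒩.connectedComponentIn_pruned hQ hN hd hxQ hxN).symm⟩
    -- A region may be represented by a boundary point of `Q`, but a convex set with interior points
    -- lies in the closure of its interior, so the open set `interior N` also meets `interior Q`.
    have hcl : x ∈ closure (interior Q) := by
      rw [hQ.closure_interior_eq_closure_of_nonempty_interior hQi]
      exact subset_closure hxQ
    exact mem_closure_iff.mp hcl _ isOpen_interior hxN
  · rintro ⟨N, ⟨hN, hd, x, hxN, hxQ⟩, rfl⟩
    have hxQ' := interior_subset hxQ
    exact ⟨x, (h𝒩.mem_pruned_iff Q x).mpr ⟨hxQ', N, hN, hd, hxN⟩,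
      (h𝒩.connectedComponentIn_pruned hQ hN hd hxQ' hxN).symm⟩

theorem closure_region {Q N : Set (Fin d → ℝ)} (hQ : Convex ℝ Q) (hQc : IsClosed Q) (hN : N ∈ 𝒩)
    (hne : (interior N ∩ interior Q).Nonempty) : closure (Q ∩ interior N) = N ∩ Q := by
  refine Set.Subset.antisymm ?_ ?_
  · refine closure_minimal (fun x hx => ⟨interior_subset hx.2, hx.1⟩) ((h𝒩.isClosed hN).inter hQc)
  · have h1 : closure (interior (N ∩ Q)) = closure (N ∩ Q) :=
      ((h𝒩.convex hN).inter hQ).closure_interior_eq_closure_of_nonempty_interior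
        (by rwa [interior_inter])
    refine subset_closure.trans (h1.ge.trans (closure_mono ?_))
    rw [interior_inter]
    exact fun x hx => ⟨interior_subset hx.2, hx.1⟩

end IsCompleteFan

/-! ### The pruned Ehrhart functions as sums over full-dimensional cones -/

open Classical in
theorem ehr_eq_sum {A Q : Set (Fin d → ℝ)} (h : A ⊆ Q) (hQ : Bornology.IsBounded Q) {t : ℕ}
    (ht : 0 < t) : ehr A t = ∑ z ∈ (finite_latticePoint_mem hQ ht).toFinset,
      if latticePoint t z ∈ A then 1 else 0 := by
  rw [Finset.sum_boole, ehr, Nat.cast_id, ← Set.ncard_coe_finset]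
  congr 1
  ext z
  simp only [Finset.coe_filter, Set.Finite.mem_toFinset, Set.mem_ofPred_eq]
  exact ⟨fun hz => ⟨h hz, hz⟩, And.right⟩

theorem ehr_mono {A Q : Set (Fin d → ℝ)} (h : A ⊆ Q) (hQ : Bornology.IsBounded Q) {t : ℕ}
    (ht : 0 < t) : ehr A t ≤ ehr Q t :=
  Set.ncard_le_ncard (fun _ hz => h hz) (finite_latticePoint_mem hQ ht)

/-- Double counting of the pairs of a lattice point of `Q` and a full-dimensional cone containing
it. -/
theorem cumulativeEhr_eq_sum {Q : Set (Fin d → ℝ)} (hQ : Bornology.IsBounded Q)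
    {𝒩 : Set (Set (Fin d → ℝ))} {s : Finset (Set (Fin d → ℝ))}
    (hs : ∀ N, N ∈ s ↔ N ∈ 𝒩 ∧ dim N = d) {t : ℕ} (ht : 0 < t) :
    cumulativeEhr Q 𝒩 t = ∑ N ∈ s, ehr (N ∩ Q) t := by
  classical
  rw [Finset.sum_congr rfl fun N _ => ehr_eq_sum Set.inter_subset_right hQ ht, Finset.sum_comm,
    cumulativeEhr, finsum_eq_sum_of_support_subset (s := (finite_latticePoint_mem hQ ht).toFinset)]
  · refine Finset.sum_congr rfl fun z hz => ?_
    rw [Set.Finite.mem_toFinset] at hz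
    have hz' : latticePoint t z ∈ Q := hz
    refine Eq.trans ?_ (@Finset.card_filter _ (fun N => latticePoint t z ∈ N ∩ Q) (Classical.decPred _) s)
    rw [mult, if_pos hz', ← Set.ncard_coe_finset]
    congr 1
    ext N
    simp only [Finset.coe_filter, Set.mem_ofPred_eq, hs, Set.mem_inter_iff]
    exact ⟨fun h => ⟨⟨h.1, h.2.1⟩, h.2.2, hz⟩, fun h => ⟨h.1.1, h.1.2, h.2.1⟩⟩
  · intro z hz
    rw [Function.mem_support, mult] at hz
    rw [Finset.mem_coe, Set.Finite.mem_toFinset]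
    by_contra h
    exact hz (if_neg h)

theorem IsCompleteFan.innerEhr_eq_sum {Q : Set (Fin d → ℝ)} (hQ : Bornology.IsBounded Q)
    {𝒩 : Set (Set (Fin d → ℝ))} (h𝒩 : IsCompleteFan 𝒩) {s : Finset (Set (Fin d → ℝ))}
    (hs : ∀ N, N ∈ s ↔ N ∈ 𝒩 ∧ dim N = d ∧ (interior N ∩ interior Q).Nonempty) {t : ℕ} (ht : 0 < t) :
    innerEhr (interior Q) 𝒩 t = ∑ N ∈ s, ehr (interior (N ∩ Q)) t := by
  classical
  rw [Finset.sum_congr rfl fun N _ => ehr_eq_sum (interior_subset.trans Set.inter_subset_right) hQ ht,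
    Finset.sum_comm, innerEhr, ehr_eq_sum (A := pruned (interior Q) 𝒩) (fun _ hx => interior_subset hx.1) hQ ht]
  refine Finset.sum_congr rfl fun z _ => ?_
  simp only [interior_inter]
  by_cases hz : latticePoint t z ∈ pruned (interior Q) 𝒩
  · obtain ⟨hzQ, N, hN, hd, hzN⟩ := (h𝒩.mem_pruned_iff _ _).mp hz
    rw [if_pos hz, Finset.sum_eq_single N, if_pos ⟨hzN, hzQ⟩]
    · intro N' hN' hne
      exact if_neg fun h => hne (h𝒩.eq_of_mem_interior ((hs N').mp hN').1 hN h.1 hzN)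
    · exact fun h => absurd ((hs N).mpr ⟨hN, hd, _, hzN, hzQ⟩) h
  · rw [if_neg hz, Finset.sum_eq_zero]
    intro N hN
    obtain ⟨hN, hd, -⟩ := (hs N).mp hN
    exact if_neg fun h => hz ((h𝒩.mem_pruned_iff _ _).mpr ⟨h.2, N, hN, hd, h.1⟩)

theorem IsCompleteFan.closedRegionEhr_eq_sum {Q : Set (Fin d → ℝ)} (hQ : Convex ℝ Q)
    (hQc : IsClosed Q) (hQi : (interior Q).Nonempty)
    {𝒩 : Set (Set (Fin d → ℝ))} (h𝒩 : IsCompleteFan 𝒩) {s : Finset (Set (Fin d → ℝ))}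
    (hs : ∀ N, N ∈ s ↔ N ∈ 𝒩 ∧ dim N = d ∧ (interior N ∩ interior Q).Nonempty) (t : ℕ) :
    closedRegionEhr Q 𝒩 t = ∑ N ∈ s, ehr (N ∩ Q) t := by
  have hset : {N ∈ 𝒩 | dim N = d ∧ (interior N ∩ interior Q).Nonempty} = (s : Set _) := by
    ext N
    rw [Finset.mem_coe, hs]
    rfl
  rw [closedRegionEhr, h𝒩.regions_eq hQ hQi, hset, finsum_mem_image, finsum_mem_coe_finset]
  · refine Finset.sum_congr rfl fun N hN => ?_
    obtain ⟨hN, -, hne⟩ := (hs N).mp hN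
    rw [h𝒩.closure_region hQ hQc hN hne]
  -- Distinct cones give distinct regions, so the sum over the set of regions loses no multiplicity.
  · intro N hN N' hN' heq
    obtain ⟨hN, -, x, hxN, hxQ⟩ := (hs N).mp hN
    obtain ⟨hN', -, -⟩ := (hs N').mp hN'
    have hx : x ∈ Q ∩ interior N := ⟨interior_subset hxQ, hxN⟩
    have heq' : Q ∩ interior N = Q ∩ interior N' := heq
    rw [heq'] at hx
    exact h𝒩.eq_of_mem_interior hN hN' hxN hx.2

end PrunedEhrhart

end

/-! ### Assembly of the theorem from the contributions of single cones -/

open PrunedEhrhart in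
theorem mainTheorem3 (d : ℕ) (Q : Set (Fin d → ℝ)) (𝒩 : Set (Set (Fin d → ℝ)))
    (hQ : PrunedEhrhart.IsRationalPolytope Q) (hQne : Q.Nonempty) (hQdim : PrunedEhrhart.dim Q = d)
    (h𝒩 : PrunedEhrhart.IsCompleteFan 𝒩) (h𝒩rat : PrunedEhrhart.IsRationalFan 𝒩) :
    ∃ inn cum reg : ℤ → ℝ,
      PrunedEhrhart.IsQuasipolynomial inn d ∧
      PrunedEhrhart.IsQuasipolynomial cum d ∧
      PrunedEhrhart.IsQuasipolynomial reg d ∧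
      (∀ t : ℕ, 0 < t → inn (t : ℤ) = (PrunedEhrhart.innerEhr (interior Q) 𝒩 t : ℝ)) ∧
      (∀ t : ℕ, 0 < t → cum (t : ℤ) = (PrunedEhrhart.cumulativeEhr Q 𝒩 t : ℝ)) ∧
      (∀ t : ℕ, 0 < t → reg (t : ℤ) = (PrunedEhrhart.closedRegionEhr Q 𝒩 t : ℝ)) ∧
      (∀ t : ℤ, (-1 : ℝ) ^ d * inn (-t) = reg t) ∧
      ((∀ N ∈ 𝒩, PrunedEhrhart.dim N = d → (N ∩ Q).Nonempty → (N ∩ interior Q).Nonempty) →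
        ∀ t : ℤ, (-1 : ℝ) ^ d * inn (-t) = cum t) := by
  classical
  have hQint := hQ.isIntegralPolyhedron
  obtain ⟨hQconv, hQcpt⟩ : Convex ℝ Q ∧ IsCompact Q := by
    obtain ⟨S, -, rfl⟩ := hQ
    exact ⟨convex_convexHull ℝ _, S.finite_toSet.isCompact_convexHull (𝕜 := ℝ)⟩
  have hQb := hQcpt.isBounded
  have hQi := interior_nonempty_of_dim_eq hQconv hQne hQdim
  have hNint : ∀ N ∈ 𝒩, IsIntegralPolyhedron N := by
    intro N hN
    obtain ⟨S, hS, rfl⟩ := h𝒩rat N hN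
    exact isIntegralPolyhedron_hull S hS
  let s := h𝒩.finite.toFinset.filter fun N => dim N = d
  have hs : ∀ N, N ∈ s ↔ N ∈ 𝒩 ∧ dim N = d := fun N => by simp [s]
  let s' := s.filter fun N => (interior N ∩ interior Q).Nonempty
  have hs' : ∀ N, N ∈ s' ↔ N ∈ 𝒩 ∧ dim N = d ∧ (interior N ∩ interior Q).Nonempty := fun N => by
    rw [Finset.mem_filter, hs, and_assoc]
  have hex : ∀ N ∈ 𝒩, ∃ q : ℤ → ℝ, IsQuasiPoly q ∧ (∀ t : ℕ, 0 < t → q t = ehr (N ∩ Q) t) ∧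
      ((interior (N ∩ Q)).Nonempty → ∀ t : ℕ, 0 < t →
        (-1 : ℝ) ^ d * q (-t) = ehr (interior (N ∩ Q)) t) ∧
      -- Vanishing at all integers, not only positive ones, is imposed here so that the last
      -- identity holds for every `t` without an appeal to uniqueness of quasipolynomials.
      (¬(N ∩ Q).Nonempty → ∀ t, q t = 0) := by
    intro N hN
    by_cases hne : (N ∩ Q).Nonempty
    · obtain ⟨q, hq, hqt, hqi⟩ :=
        exists_ehrhart ((hNint N hN).inter hQint) (hQb.subset Set.inter_subset_right)
      exact ⟨q, hq, hqt, hqi, fun h => absurd hne h⟩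
    · refine ⟨fun _ => 0, .zero, fun t _ => ?_, fun h => absurd (h.mono interior_subset) hne,
        fun _ _ => rfl⟩
      simp [Set.not_nonempty_iff_eq_empty.mp hne, ehr]
  choose! q hq hqt hqi hq0 using hex
  obtain ⟨N₀, hN₀, hd₀, hne₀⟩ := h𝒩.exists_interior_inter_nonempty isOpen_interior hQi
  have hquasi : ∀ r : Finset (Set (Fin d → ℝ)), (∀ N ∈ r, N ∈ 𝒩) → N₀ ∈ r →
      IsQuasipolynomial (fun t => ∑ N ∈ r, q N t) d := by
    intro r hr hN₀r
    obtain ⟨C, -, hC⟩ := exists_ehr_le hQb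
    obtain ⟨κ, hκ, T, hT⟩ := exists_le_ehr (hQb.subset (Set.inter_subset_right (s := N₀)))
      (by rwa [interior_inter])
    have hval : ∀ t : ℕ, 0 < t → ∑ N ∈ r, q N t = ∑ N ∈ r, (ehr (N ∩ Q) t : ℝ) := fun t ht =>
      Finset.sum_congr rfl fun N hN => hqt N (hr N hN) t ht
    refine (IsQuasiPoly.sum r fun N hN => hq N (hr N hN)).isQuasipolynomial (C := r.card * C)
      (T := T + 1) hκ (fun t ht => ?_) (fun t ht => ?_) (fun t ht => ?_)
    · rw [hval t ht]
      positivity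
    · rw [hval t ht, mul_assoc, ← nsmul_eq_mul]
      refine Finset.sum_le_card_nsmul _ _ _ fun N _ => ?_
      exact le_trans (by exact_mod_cast ehr_mono Set.inter_subset_right hQb ht) (hC t ht)
    · rw [hval t (by omega)]
      exact (hT t (by omega)).trans
        (Finset.single_le_sum (f := fun N => (ehr (N ∩ Q) t : ℝ)) (fun _ _ => by positivity) hN₀r)
  have hreg := hquasi s' (fun N hN => ((hs' N).mp hN).1) ((hs' N₀).mpr ⟨hN₀, hd₀, hne₀⟩)
  have hcum := hquasi s (fun N hN => ((hs N).mp hN).1) ((hs N₀).mpr ⟨hN₀, hd₀⟩)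
  have hrec : ∀ t : ℤ, (-1 : ℝ) ^ d * ((-1 : ℝ) ^ d * ∑ N ∈ s', q N (- -t)) = ∑ N ∈ s', q N t := by
    intro t
    rw [← mul_assoc, ← mul_pow, neg_neg]
    simp
  -- The inner function is defined as the reflection of the regional one, so the identity for all
  -- `t` is formal; reciprocity enters in matching it with the count for `t > 0`.
  refine ⟨fun t => (-1 : ℝ) ^ d * ∑ N ∈ s', q N (-t), fun t => ∑ N ∈ s, q N t,
    fun t => ∑ N ∈ s', q N t, hreg.reflect, hcum, hreg, fun t ht => ?_, fun t ht => ?_, fun t ht => ?_,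
    hrec, fun hmeet t => ?_⟩
  · beta_reduce
    rw [h𝒩.innerEhr_eq_sum hQb hs' ht, Finset.mul_sum, Nat.cast_sum]
    refine Finset.sum_congr rfl fun N hN => ?_
    obtain ⟨hN, -, hne⟩ := (hs' N).mp hN
    exact hqi N hN (by rwa [interior_inter]) t ht
  · rw [cumulativeEhr_eq_sum hQb hs ht, Nat.cast_sum]
    exact Finset.sum_congr rfl fun N hN => hqt N ((hs N).mp hN).1 t ht
  · rw [h𝒩.closedRegionEhr_eq_sum hQconv hQcpt.isClosed hQi hs', Nat.cast_sum]
    exact Finset.sum_congr rfl fun N hN => hqt N ((hs' N).mp hN).1 t ht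
  · rw [hrec]
    refine Finset.sum_subset (Finset.filter_subset _ _) fun N hN hN' => ?_
    obtain ⟨hN, hd⟩ := (hs N).mp hN
    refine hq0 N hN (fun hne => hN' ((hs' N).mpr ⟨hN, hd, ?_⟩)) t
    obtain ⟨x, hxN, hxQ⟩ := hmeet N hN hd hne
    -- A full-dimensional cone is in the closure of its interior, so meeting the open set `interior
    -- Q` already forces `interior N` to meet it. Thus cones outside `s'` miss `Q` and contribute
    -- zero.
    have hcl : x ∈ closure (interior N) := by
      rw [(h𝒩.convex hN).closure_interior_eq_closure_of_nonempty_interior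
        (interior_nonempty_of_dim_eq (h𝒩.convex hN) ⟨x, hxN⟩ hd)]
      exact subset_closure hxN
    rw [Set.inter_comm]
    exact mem_closure_iff.mp hcl _ isOpen_interior hxQ
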